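/- Let $(\Omega,\mathcal F,\mu)$ be a measure space, $p\in(1,\infty)$, $k\ge 1$ an integer, and $X$ a Banach space whose norm is uniformly convex and Gâteaux differentiable (that is, $\lim_{t\to 0}\frac{\|z+tv\|-\|z\|}{t}$ exists for all $z\in X\setminus\{0\}$ and $v\in X$). Let $L^p(X)=L^p(\Omega,\mathcal F,\mu,X)$ be the Bochner space with its norm $\|\cdot\|_p$, and let $$\mathscr G_{p,k}(X)=\Big\{\sum_{i=1}^{l}x_i\mathbf 1_{A_i}\in L^p(X)\ :\ l\le k,\ \{A_i\}_{1\le i\le l}\subset\mathcal F\text{ a partition of }\Omega,\ x_1,\dots,x_l\in X\Big\}.$$ For $f\in L^p(X)$ put $\mathscr D_{p,k}(f)=\inf_{g\in\mathscr G_{p,k}(X)}\|f-g\|_p$; a sequence $(h_n)$ in $\mathscr G_{p,k}(X)$ is called minimizing for $f$ if $\|f-h_n\|_p\to\mathscr D_{p,k}(f)$, and $g\in\mathscr G_{p,k}(X)$ is called a minimizer for $f$ if $\|f-g\|_p=\mathscr D_{p,k}(f)$. Then $\mathscr G_{p,k}(X)$ is approximatively norm-compact in $L^p(X)$: for every $f\in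 L^p(X)$, every minimizing sequence for $f$ has a subnet that converges in norm to a point of $\mathscr G_{p,k}(X)$. Moreover, for every $f\in L^p(X)$, every minimizing sequence for $f$ has a subsequence that converges in norm to a minimizer for $f$. -/

import Mathlib

open MeasureTheory Filter Topology
open scoped ENNReal

/-- `kValuedSimple X p μ k` is the set `𝒢_{p,k}(X)` of (classes of) functions in `L^p(μ; X)` of the
form `∑_{i=1}^l x_i 1_{A_i}` with `l ≤ k`, a measurable partition `A_1, …, A_l` of `Ω` and
`x_1, …, x_l ∈ X`. (Empty pieces are allowed; this does not change the set.) -/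
def kValuedSimple {Ω : Type*} [MeasurableSpace Ω] (X : Type*) [NormedAddCommGroup X]
    (p : ℝ≥0∞) (μ : Measure Ω) (k : ℕ) : Set (Lp X p μ) :=
  {g | ∃ l : ℕ, l ≤ k ∧ ∃ (A : Fin l → Set Ω) (x : Fin l → X),
    (∀ i, MeasurableSet (A i)) ∧ Pairwise (fun i j => Disjoint (A i) (A j)) ∧
    (⋃ i, A i) = Set.univ ∧
    g =ᵐ[μ] fun ω => ∑ i, (A i).indicator (fun _ => x i) ω}

/-- The norm of `X` is Gâteaux differentiable: for all `z ≠ 0` and all `v`, the two-sided limit of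
`(‖z + t v‖ - ‖z‖) / t` as `t → 0` exists. (For a norm, which is convex and Lipschitz, this limit is
automatically linear and continuous in `v`.) -/
def GateauxDifferentiableNorm (X : Type*) [NormedAddCommGroup X] [NormedSpace ℝ X] : Prop :=
  ∀ z : X, z ≠ 0 → ∀ v : X, LineDifferentiableAt ℝ (fun y : X => ‖y‖) z v

/-- `w` is a minimizing sequence for `z` in `K`. -/
def IsMinimizingSeq {Z : Type*} [NormedAddCommGroup Z] (K : Set Z) (z : Z) (w : ℕ → Z) : Prop :=
  (∀ n, w n ∈ K) ∧ Tendsto (fun n => ‖z - w n‖) atTop (𝓝 (Metric.infDist z K))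

/-- `w` is a minimizer for `z` in `K`. -/
def IsMinimizer {Z : Type*} [NormedAddCommGroup Z] (K : Set Z) (z w : Z) : Prop :=
  w ∈ K ∧ ‖z - w‖ = Metric.infDist z K

/-- `K` is approximatively norm-compact: for every `z`, every minimizing sequence for `z` has
a subnet (indexed by a nonempty directed set) that converges in norm to a point of `K`. -/
def ApproximativelyNormCompact {Z : Type*} [NormedAddCommGroup Z] (K : Set Z) : Prop :=
  ∀ (z : Z) (w : ℕ → Z), IsMinimizingSeq K z w →
    ∃ (ι : Type) (_ : Preorder ι) (_ : Nonempty ι) (_ : IsDirectedOrder ι) (φ : ι → ℕ),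
      Tendsto φ atTop atTop ∧ ∃ g ∈ K, Tendsto (fun i => w (φ i)) atTop (𝓝 g)

/-
Write a `k`-valued function as `x ∘ κ`, where `κ` labels the points of `Ω` by finitely many labels.
Along a subsequence of a minimizing sequence, the labels whose cells have measure tending to `0` can
be discarded. On every other cell the value is a nearly optimal constant, and so is, by the
triangle inequality, the value taken at another index, because the distances from it to each value
of a simple function close to `f` converge; hence uniform convexity, applied to the midpoint, makes
the values Cauchy (they tend to `0` if the measure of the cell tends to `∞`). Assigning to each
point the nearest limit value gives a minimizer by Fatou's lemma. Moving a piece of the set where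
two values tie from one cell to the other costs nothing, so by the first-order condition that
Gâteaux differentiability provides, ties between distinct values occur on null sets only. Therefore
the functions converge almost everywhere, and uniform convexity upgrades this to norm convergence.
-/

theorem convexOn_norm_rpow {X : Type*} [NormedAddCommGroup X] [NormedSpace ℝ X] {q : ℝ}
    (hq : 1 ≤ q) : ConvexOn ℝ Set.univ (fun u : X => ‖u‖ ^ q) := by
  refine ⟨convex_univ, fun u _ v _ a b ha hb hab => ?_⟩
  calc ‖a • u + b • v‖ ^ q ≤ (a • ‖u‖ + b • ‖v‖) ^ q := by
        gcongr
        exact convexOn_univ_norm.2 (Set.mem_univ u) (Set.mem_univ v) ha hb hab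
    _ ≤ a • ‖u‖ ^ q + b • ‖v‖ ^ q :=
        (convexOn_rpow hq).2 (norm_nonneg u) (norm_nonneg v) ha hb hab

theorem norm_midpoint_rpow_le {X : Type*} [NormedAddCommGroup X] [NormedSpace ℝ X] {q : ℝ}
    (hq : 1 ≤ q) (u v : X) : ‖(2⁻¹ : ℝ) • (u + v)‖ ^ q ≤ (‖u‖ ^ q + ‖v‖ ^ q) / 2 := by
  have h := (convexOn_norm_rpow (X := X) hq).2 (Set.mem_univ u) (Set.mem_univ v)
    (inv_nonneg.2 zero_le_two) (inv_nonneg.2 zero_le_two) (by norm_num)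
  simp only [smul_eq_mul, ← smul_add] at h
  linarith

theorem exists_min_midpoint_rpow_add_le {q θ : ℝ} (hq : 1 < q) (hθ₀ : 0 ≤ θ) (hθ : θ < 1) :
    ∃ c > 0, ∀ t ∈ Set.Icc (0 : ℝ) 1, min θ ((1 + t) / 2) ^ q + c ≤ (1 + t ^ q) / 2 := by
  have hq₀ : 0 < q := by linarith
  let gap : ℝ → ℝ := fun t => (1 + t ^ q) / 2 - min θ ((1 + t) / 2) ^ q
  have hgap : Continuous gap := by
    have hpow : Continuous fun s : ℝ => s ^ q := Real.continuous_rpow_const hq₀.le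
    exact (by fun_prop : Continuous fun t : ℝ => (1 + t ^ q) / 2).sub
      (hpow.comp (by fun_prop : Continuous fun t => min θ ((1 + t) / 2)))
  have hpos : ∀ t ∈ Set.Icc (0 : ℝ) 1, 0 < gap t := by
    rintro t ⟨ht₀, ht₁⟩
    refine sub_pos.2 ?_
    rcases ht₁.eq_or_lt with rfl | ht₁
    · calc min θ ((1 + 1) / 2) ^ q ≤ θ ^ q :=
            Real.rpow_le_rpow (le_min hθ₀ (by norm_num)) (min_le_left _ _) hq₀.le
        _ < 1 := Real.rpow_lt_one hθ₀ hθ hq₀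
        _ = (1 + 1 ^ q) / 2 := by norm_num
    · calc min θ ((1 + t) / 2) ^ q ≤ ((1 + t) / 2) ^ q :=
            Real.rpow_le_rpow (le_min hθ₀ (by linarith)) (min_le_right _ _) hq₀.le
        _ = (2⁻¹ * 1 + 2⁻¹ * t) ^ q := by ring_nf
        _ < 2⁻¹ * 1 ^ q + 2⁻¹ * t ^ q :=
            (strictConvexOn_rpow hq).2 (Set.mem_Ici.2 zero_le_one) ht₀ ht₁.ne'
            (by norm_num) (by norm_num) (by norm_num)
        _ = (1 + t ^ q) / 2 := by rw [Real.one_rpow]; ring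
  obtain ⟨s, hs, hmin⟩ := isCompact_Icc.exists_isMinOn
    (Set.nonempty_Icc.2 (zero_le_one' ℝ)) hgap.continuousOn
  refine ⟨gap s, hpos s hs, fun t ht => ?_⟩
  have : gap s ≤ (1 + t ^ q) / 2 - min θ ((1 + t) / 2) ^ q := hmin ht
  linarith

theorem exists_norm_midpoint_rpow_add_le_of_norm_le_one (X : Type*) [NormedAddCommGroup X]
    [NormedSpace ℝ X] [UniformConvexSpace X] {q τ : ℝ} (hq : 1 < q) (hτ : 0 < τ) :
    ∃ c > 0, ∀ u v : X, ‖u‖ = 1 → ‖v‖ ≤ 1 → τ ≤ ‖u - v‖ →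
      ‖(2⁻¹ : ℝ) • (u + v)‖ ^ q + c ≤ (‖u‖ ^ q + ‖v‖ ^ q) / 2 := by
  obtain ⟨δ, hδ, hsum⟩ := exists_forall_closed_ball_dist_add_le_two_sub X hτ
  obtain ⟨c, hc, hgap⟩ := exists_min_midpoint_rpow_add_le hq (le_max_right (1 - δ / 2) 0)
    (max_lt (by linarith) one_pos)
  refine ⟨c, hc, fun u v hu hv huv => ?_⟩
  have hmid : ‖(2⁻¹ : ℝ) • (u + v)‖ = ‖u + v‖ / 2 := by
    rw [norm_smul, Real.norm_of_nonneg (by norm_num)]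
    ring
  rw [hu, Real.one_rpow]
  refine le_trans ?_ (hgap ‖v‖ ⟨norm_nonneg v, hv⟩)
  gcongr
  refine le_min (le_max_of_le_left ?_) ?_
  · linarith [hsum hu.le hv huv]
  · linarith [norm_add_le u v]

theorem exists_mul_norm_rpow_le_midpoint_gap (X : Type*) [NormedAddCommGroup X]
    [NormedSpace ℝ X] [UniformConvexSpace X] {q τ : ℝ} (hq : 1 < q) (hτ : 0 < τ) :
    ∃ c > 0, ∀ u v : X, ‖v‖ ≤ ‖u‖ → τ * ‖u‖ ≤ ‖u - v‖ →
      c * ‖u‖ ^ q ≤ (‖u‖ ^ q + ‖v‖ ^ q) / 2 - ‖(2⁻¹ : ℝ) • (u + v)‖ ^ q := by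
  obtain ⟨c, hc, hgap⟩ := exists_norm_midpoint_rpow_add_le_of_norm_le_one X hq hτ
  refine ⟨c, hc, fun u v huv hfar => ?_⟩
  rcases eq_or_ne u 0 with rfl | hu₀
  · obtain rfl : v = 0 := by simpa using huv
    simp [Real.zero_rpow (one_pos.trans hq).ne']
  have hu : 0 < ‖u‖ := norm_pos_iff.2 hu₀
  have hnorm : ∀ w : X, ‖‖u‖⁻¹ • w‖ = ‖w‖ / ‖u‖ := fun w => by
    rw [norm_smul, norm_inv, norm_norm, inv_mul_eq_div]
  have hunit := hgap (‖u‖⁻¹ • u) (‖u‖⁻¹ • v) (by rw [hnorm, div_self hu.ne'])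
    (by rwa [hnorm, div_le_one hu]) (by rwa [← smul_sub, hnorm, le_div_iff₀ hu])
  have hpow : 0 < ‖u‖ ^ q := by positivity
  rw [← smul_add, smul_comm] at hunit
  simp only [hnorm, Real.div_rpow (norm_nonneg _) hu.le] at hunit
  field_simp at hunit ⊢
  linarith

theorem exists_norm_sub_rpow_le_add_midpoint_gap (X : Type*) [NormedAddCommGroup X]
    [NormedSpace ℝ X] [UniformConvexSpace X] {q ε : ℝ} (hq : 1 < q) (hε : 0 < ε) :
    ∃ C > 0, ∀ u v : X, ‖u - v‖ ^ q ≤ ε * (‖u‖ ^ q + ‖v‖ ^ q) +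
      C * ((‖u‖ ^ q + ‖v‖ ^ q) / 2 - ‖(2⁻¹ : ℝ) • (u + v)‖ ^ q) := by
  have hq₀ : 0 < q := by linarith
  obtain ⟨c, hc, hgap⟩ := exists_mul_norm_rpow_le_midpoint_gap X hq (Real.rpow_pos_of_pos hε q⁻¹)
  refine ⟨2 ^ q / c, by positivity, fun u v => ?_⟩
  wlog huv : ‖v‖ ≤ ‖u‖ generalizing u v
  · simpa only [norm_sub_rev, add_comm] using this v u (le_of_not_ge huv)
  have hmid := norm_midpoint_rpow_le hq.le u v
  rcases le_total ‖u - v‖ (ε ^ q⁻¹ * ‖u‖) with hclose | hfar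
  · refine le_add_of_le_of_nonneg ?_ (mul_nonneg (by positivity) (by linarith))
    calc ‖u - v‖ ^ q ≤ (ε ^ q⁻¹ * ‖u‖) ^ q := by gcongr
      _ = ε * ‖u‖ ^ q := by
          rw [Real.mul_rpow (by positivity) (norm_nonneg u), Real.rpow_inv_rpow hε.le hq₀.ne']
      _ ≤ ε * (‖u‖ ^ q + ‖v‖ ^ q) := by
          gcongr
          exact le_add_of_nonneg_right (by positivity)
  · have hdiff : ‖u - v‖ ^ q ≤ 2 ^ q * ‖u‖ ^ q := by
      rw [← Real.mul_rpow zero_le_two (norm_nonneg u)]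
      gcongr
      linarith [norm_sub_le u v]
    calc ‖u - v‖ ^ q ≤ 2 ^ q / c * (c * ‖u‖ ^ q) := hdiff.trans_eq (by field_simp)
      _ ≤ 2 ^ q / c * ((‖u‖ ^ q + ‖v‖ ^ q) / 2 - ‖(2⁻¹ : ℝ) • (u + v)‖ ^ q) := by
          gcongr
          exact hgap u v huv hfar
      _ ≤ _ := le_add_of_nonneg_left (by positivity)

theorem eLpNorm_rpow_toReal {Ω : Type*} [MeasurableSpace Ω] {X : Type*} [NormedAddCommGroup X]
    {p : ℝ≥0∞} (hp₀ : p ≠ 0) (hp : p ≠ ∞) (ν : Measure Ω) (F : Ω → X) :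
    eLpNorm F p ν ^ p.toReal = ∫⁻ ω, ‖F ω‖ₑ ^ p.toReal ∂ν := by
  rw [eLpNorm_eq_lintegral_rpow_enorm_toReal hp₀ hp, one_div,
    ENNReal.rpow_inv_rpow (ENNReal.toReal_pos hp₀ hp).ne']

section UniformConvexity

variable {Ω : Type*} [MeasurableSpace Ω] {X : Type*} [NormedAddCommGroup X] {p : ℝ≥0∞}

theorem exists_enorm_sub_rpow_add_le (X : Type*) [NormedAddCommGroup X]
    [NormedSpace ℝ X] [UniformConvexSpace X] {q : ℝ} (hq : 1 < q) {ε : ℝ≥0∞} (hε : ε ≠ 0)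
    (hε_top : ε ≠ ∞) :
    ∃ C ≠ ∞, ∀ u v : X, ‖u - v‖ₑ ^ q + 2 * C * ‖(2⁻¹ : ℝ) • (u + v)‖ₑ ^ q ≤
      (ε + C) * (‖u‖ₑ ^ q + ‖v‖ₑ ^ q) := by
  obtain ⟨C, hC, h⟩ := exists_norm_sub_rpow_le_add_midpoint_gap X hq (ENNReal.toReal_pos hε hε_top)
  have hpow : ∀ w : X, ‖w‖ₑ ^ q = ENNReal.ofReal (‖w‖ ^ q) := fun w => by
    rw [← ofReal_norm, ENNReal.ofReal_rpow_of_nonneg (norm_nonneg w) (by linarith)]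
  refine ⟨ENNReal.ofReal (C / 2), ENNReal.ofReal_ne_top, fun u v => ?_⟩
  rw [← ENNReal.ofReal_toReal hε_top, ← ENNReal.ofReal_ofNat 2]
  simp only [hpow]
  rw [← ENNReal.ofReal_mul (by positivity), ← ENNReal.ofReal_mul (by positivity),
    ← ENNReal.ofReal_add (by positivity) (by positivity),
    ← ENNReal.ofReal_add (by positivity) (by positivity),
    ← ENNReal.ofReal_add (by positivity) (by positivity), ← ENNReal.ofReal_mul (by positivity)]
  refine ENNReal.ofReal_le_ofReal ?_
  linarith [h u v]

theorem exists_eLpNorm_sub_rpow_add_le (Ω : Type*) [MeasurableSpace Ω] (X : Type*)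
    [NormedAddCommGroup X] [NormedSpace ℝ X] [UniformConvexSpace X] (hp₁ : 1 < p) (hp : p ≠ ∞)
    {ε : ℝ≥0∞} (hε : ε ≠ 0) (hε_top : ε ≠ ∞) :
    ∃ C ≠ ∞, ∀ (ν : Measure Ω) (F G : Ω → X), AEStronglyMeasurable F ν →
      eLpNorm (F - G) p ν ^ p.toReal +
          2 * C * eLpNorm ((2⁻¹ : ℝ) • (F + G)) p ν ^ p.toReal ≤
        (ε + C) * (eLpNorm F p ν ^ p.toReal + eLpNorm G p ν ^ p.toReal) := by
  have hq : 1 < p.toReal := by rwa [← ENNReal.toReal_one, ENNReal.toReal_lt_toReal (by simp) hp]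
  obtain ⟨C, hC, h⟩ := exists_enorm_sub_rpow_add_le X hq hε hε_top
  refine ⟨C, hC, fun ν F G hF => ?_⟩
  simp only [eLpNorm_rpow_toReal (one_pos.trans hp₁).ne' hp, Pi.sub_apply, Pi.smul_apply,
    Pi.add_apply]
  rw [← lintegral_const_mul' _ _ (by finiteness),
    ← lintegral_add_left' (hF.enorm.pow_const _), ← lintegral_const_mul' _ _ (by finiteness)]
  exact (le_lintegral_add _ _).trans (lintegral_mono fun ω => h (F ω) (G ω))

theorem tendsto_eLpNorm_midpoint [NormedSpace ℝ X] (hp₁ : 1 ≤ p) {κ : Type*}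
    {l : Filter κ} {ν : κ → Measure Ω} {F G : κ → Ω → X}
    (hF : ∀ i, AEStronglyMeasurable (F i) (ν i)) (hG : ∀ i, AEStronglyMeasurable (G i) (ν i))
    {D : ℝ≥0∞} (hFD : Tendsto (fun i => eLpNorm (F i) p (ν i)) l (𝓝 D))
    (hGD : Tendsto (fun i => eLpNorm (G i) p (ν i)) l (𝓝 D))
    (hmid : D ≤ liminf (fun i => eLpNorm ((2⁻¹ : ℝ) • (F i + G i)) p (ν i)) l) :
    Tendsto (fun i => eLpNorm ((2⁻¹ : ℝ) • (F i + G i)) p (ν i)) l (𝓝 D) := by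
  rcases l.eq_or_neBot with rfl | hl
  · exact tendsto_bot
  have hle : ∀ i, eLpNorm ((2⁻¹ : ℝ) • (F i + G i)) p (ν i) ≤
      2⁻¹ * (eLpNorm (F i) p (ν i) + eLpNorm (G i) p (ν i)) := fun i => by
    rw [eLpNorm_const_smul, enorm_inv two_ne_zero,
      show ‖(2 : ℝ)‖ₑ = 2 from Real.enorm_natCast 2]
    gcongr
    exact eLpNorm_add_le (hF i) (hG i) hp₁
  refine tendsto_of_le_liminf_of_limsup_le hmid ((limsup_le_limsup (.of_forall hle)).trans ?_)
  refine (ENNReal.Tendsto.const_mul (hFD.add hGD) (.inr (by simp))).limsup_eq.le.trans_eq ?_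
  rw [← two_mul, ENNReal.inv_mul_cancel_left' (by simp) (by simp)]

theorem limsup_eLpNorm_sub_rpow_le [NormedSpace ℝ X] [UniformConvexSpace X] (hp₁ : 1 < p)
    (hp : p ≠ ∞) {κ : Type*} {l : Filter κ} [l.NeBot] {ν : κ → Measure Ω} {F G : κ → Ω → X}
    (hF : ∀ i, AEStronglyMeasurable (F i) (ν i)) {D : ℝ≥0∞} (hD : D ≠ ∞)
    (hFD : Tendsto (fun i => eLpNorm (F i) p (ν i)) l (𝓝 D))
    (hGD : Tendsto (fun i => eLpNorm (G i) p (ν i)) l (𝓝 D))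
    (hmid : Tendsto (fun i => eLpNorm ((2⁻¹ : ℝ) • (F i + G i)) p (ν i)) l (𝓝 D))
    {ε : ℝ≥0∞} (hε : ε ≠ 0) (hε_top : ε ≠ ∞) :
    limsup (fun i => eLpNorm (F i - G i) p (ν i) ^ p.toReal) l ≤ ε * (2 * D ^ p.toReal) := by
  obtain ⟨C, hC, h⟩ := exists_eLpNorm_sub_rpow_add_le Ω X hp₁ hp hε hε_top
  have hDq : D ^ p.toReal ≠ ∞ := by finiteness
  have hgap := ENNReal.Tendsto.sub
    (ENNReal.Tendsto.const_mul (a := ε + C)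
      ((hFD.ennrpow_const p.toReal).add (hGD.ennrpow_const p.toReal)) (.inr (by finiteness)))
    (ENNReal.Tendsto.const_mul (a := 2 * C) (hmid.ennrpow_const p.toReal) (.inr (by finiteness)))
    (.inl (by finiteness))
  calc _ ≤ _ := limsup_le_limsup ((hmid.eventually_ne hD).mono fun i hi =>
        ENNReal.le_sub_of_add_le_right (by finiteness) (h (ν i) (F i) (G i) (hF i)))
    _ = _ := hgap.limsup_eq
    _ = ε * (2 * D ^ p.toReal) := by
      rw [← two_mul, add_mul, mul_comm 2 C, mul_assoc C,
        ENNReal.add_sub_cancel_right (by finiteness)]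

theorem tendsto_eLpNorm_sub_zero_of_midpoint [NormedSpace ℝ X] [UniformConvexSpace X]
    (hp₁ : 1 < p) (hp : p ≠ ∞) {κ : Type*} {l : Filter κ} {ν : κ → Measure Ω} {F G : κ → Ω → X}
    (hF : ∀ i, AEStronglyMeasurable (F i) (ν i)) (hG : ∀ i, AEStronglyMeasurable (G i) (ν i))
    {D : ℝ≥0∞} (hD : D ≠ ∞) (hFD : Tendsto (fun i => eLpNorm (F i) p (ν i)) l (𝓝 D))
    (hGD : Tendsto (fun i => eLpNorm (G i) p (ν i)) l (𝓝 D))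
    (hmid : D ≤ liminf (fun i => eLpNorm ((2⁻¹ : ℝ) • (F i + G i)) p (ν i)) l) :
    Tendsto (fun i => eLpNorm (F i - G i) p (ν i)) l (𝓝 0) := by
  rcases l.eq_or_neBot with rfl | hl
  · exact tendsto_bot
  have hq : 0 < p.toReal := ENNReal.toReal_pos (one_pos.trans hp₁).ne' hp
  have hbound : Tendsto (fun ε => ε * (2 * D ^ p.toReal)) (𝓝[>] 0) (𝓝 0) := by
    simpa only [zero_mul, id] using (ENNReal.Tendsto.mul_const
      (tendsto_id (α := ℝ≥0∞) (x := 𝓝 0)) (.inr (by finiteness))).mono_left nhdsWithin_le_nhds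
  have hpow : Tendsto (fun i => eLpNorm (F i - G i) p (ν i) ^ p.toReal) l (𝓝 0) := by
    refine tendsto_of_le_liminf_of_limsup_le bot_le (ge_of_tendsto hbound ?_)
    filter_upwards [self_mem_nhdsWithin, mem_nhdsWithin_of_mem_nhds
      (Iio_mem_nhds ENNReal.zero_lt_top)] with ε hε hε_top
    exact limsup_eLpNorm_sub_rpow_le hp₁ hp hF hD hFD hGD
      (tendsto_eLpNorm_midpoint hp₁.le hF hG hFD hGD hmid) (ne_of_gt hε) hε_top.ne
  have hroot := hpow.ennrpow_const p.toReal⁻¹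
  rw [ENNReal.zero_rpow_of_pos (inv_pos.2 hq)] at hroot
  exact hroot.congr fun i => ENNReal.rpow_rpow_inv hq.ne' _

theorem tendsto_eLpNorm_sub_zero_of_tendsto_ae [NormedSpace ℝ X] [UniformConvexSpace X]
    {μ : Measure Ω} (hp₁ : 1 < p) (hp : p ≠ ∞) {F : ℕ → Ω → X} {G : Ω → X}
    (hF : ∀ n, AEStronglyMeasurable (F n) μ) (hG : MemLp G p μ)
    (hlim : ∀ᵐ ω ∂μ, Tendsto (fun n => F n ω) atTop (𝓝 (G ω)))
    (hnorm : Tendsto (fun n => eLpNorm (F n) p μ) atTop (𝓝 (eLpNorm G p μ))) :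
    Tendsto (fun n => eLpNorm (F n - G) p μ) atTop (𝓝 0) := by
  refine tendsto_eLpNorm_sub_zero_of_midpoint hp₁ hp hF (fun _ => hG.1) hG.2.ne hnorm
    tendsto_const_nhds
    (Lp.eLpNorm_lim_le_liminf_eLpNorm (fun n => ((hF n).add hG.1).const_smul _) G ?_)
  filter_upwards [hlim] with ω hω
  have := (hω.add_const (G ω)).const_smul (2⁻¹ : ℝ)
  rwa [← two_smul ℝ (G ω), inv_smul_smul₀ two_ne_zero] at this

end UniformConvexity

/-- The error of best approximation of `f` in `L^p` by functions `y ∘ κ` with `κ : Ω → ι`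
measurable and `y : ι → X`. For `ι = Fin k` this is the distance `𝒟_{p,k}(f)`. -/
noncomputable def quantError {Ω : Type*} [MeasurableSpace Ω] {X : Type*} [NormedAddCommGroup X]
    (ι : Type*) [MeasurableSpace ι] (f : Ω → X) (p : ℝ≥0∞) (μ : Measure Ω) : ℝ≥0∞ :=
  ⨅ (κ : Ω → ι) (_ : Measurable κ) (y : ι → X), eLpNorm (fun ω => f ω - y (κ ω)) p μ

/-- The constant `x` is optimal up to `η` among all constants approximating `f` in `L^p(ν)`. -/
def IsNearBestConst {Ω : Type*} [MeasurableSpace Ω] {X : Type*} [NormedAddCommGroup X] (f : Ω → X)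
    (p : ℝ≥0∞) (ν : Measure Ω) (η : ℝ≥0∞) (x : X) : Prop :=
  ∀ z, eLpNorm (fun ω => f ω - x) p ν ≤ eLpNorm (fun ω => f ω - z) p ν + η

/-- The constant `x` is a best approximation of `f` in `L^p(ν)` among all constants. -/
def IsBestConst {Ω : Type*} [MeasurableSpace Ω] {X : Type*} [NormedAddCommGroup X] (f : Ω → X)
    (p : ℝ≥0∞) (ν : Measure Ω) (x : X) : Prop :=
  ∀ z, eLpNorm (fun ω => f ω - x) p ν ≤ eLpNorm (fun ω => f ω - z) p ν

section QuantError

variable {Ω : Type*} [MeasurableSpace Ω] {μ : Measure Ω} {X : Type*} [NormedAddCommGroup X]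
  {ι : Type*} [MeasurableSpace ι] {p : ℝ≥0∞} {f : Ω → X} {κ : Ω → ι}

theorem quantError_le (hκ : Measurable κ) (y : ι → X) :
    quantError ι f p μ ≤ eLpNorm (fun ω => f ω - y (κ ω)) p μ :=
  iInf₂_le_of_le κ hκ (iInf_le _ y)

theorem quantError_ne_top [Nonempty ι] (hf : MemLp f p μ) : quantError ι f p μ ≠ ∞ := by
  have h := quantError_le (μ := μ) (f := f) (p := p)
    (measurable_const (a := Classical.arbitrary ι)) (0 : ι → X)
  simp only [Pi.zero_apply, sub_zero] at h
  exact ne_top_of_le_ne_top hf.2.ne h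

theorem memLp_comp_of_eLpNorm_sub_ne_top [Finite ι] [MeasurableSingletonClass ι] {y : ι → X}
    (hf : MemLp f p μ) (hκ : Measurable κ)
    (h : eLpNorm (fun ω => f ω - y (κ ω)) p μ ≠ ∞) : MemLp (fun ω => y (κ ω)) p μ := by
  have hy : AEStronglyMeasurable (fun ω => y (κ ω)) μ :=
    (StronglyMeasurable.of_discrete.comp_measurable hκ).aestronglyMeasurable
  exact (hf.sub ⟨hf.1.sub hy, h.lt_top⟩).ae_eq (.of_forall fun ω => sub_sub_cancel _ _)

theorem eLpNorm_restrict_rpow_add_compl (hp₀ : p ≠ 0) (hp : p ≠ ∞) (F : Ω → X) {A : Set Ω}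
    (hA : MeasurableSet A) :
    eLpNorm F p (μ.restrict A) ^ p.toReal + eLpNorm F p (μ.restrict Aᶜ) ^ p.toReal =
      eLpNorm F p μ ^ p.toReal := by
  simp only [eLpNorm_rpow_toReal hp₀ hp]
  exact lintegral_add_compl _ hA

theorem isNearBestConst_restrict_fiber [MeasurableSingletonClass ι] (hp₁ : 1 ≤ p) (hp : p ≠ ∞)
    (hκ : Measurable κ) {y : ι → X} {η : ℝ≥0∞}
    (hη : eLpNorm (fun ω => f ω - y (κ ω)) p μ ^ p.toReal ≤ quantError ι f p μ ^ p.toReal + η)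
    (hcost : eLpNorm (fun ω => f ω - y (κ ω)) p μ ≠ ∞) (i : ι) :
    IsNearBestConst f p (μ.restrict (κ ⁻¹' {i})) (η ^ p.toReal⁻¹) (y i) := by
  classical
  intro z
  have hp₀ : p ≠ 0 := (one_pos.trans_le hp₁).ne'
  have hq : 1 ≤ p.toReal := by
    simpa only [ENNReal.toReal_one] using ENNReal.toReal_mono hp hp₁
  have hA : MeasurableSet (κ ⁻¹' {i}) := hκ (measurableSet_singleton i)
  set A := κ ⁻¹' {i}
  have hon : ∀ w : ι → X, eLpNorm (fun ω => f ω - w (κ ω)) p (μ.restrict A) =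
      eLpNorm (fun ω => f ω - w i) p (μ.restrict A) := fun w =>
    eLpNorm_congr_ae ((ae_restrict_mem hA).mono fun ω hω => by
      simp only [show κ ω = i from hω])
  have hoff : eLpNorm (fun ω => f ω - Function.update y i z (κ ω)) p (μ.restrict Aᶜ) =
      eLpNorm (fun ω => f ω - y (κ ω)) p (μ.restrict Aᶜ) :=
    eLpNorm_congr_ae ((ae_restrict_mem hA.compl).mono fun ω hω => by
      simp only [Function.update_of_ne (show κ ω ≠ i from hω)])
  have hupdate := quantError_le (μ := μ) (f := f) (p := p) hκ (Function.update y i z)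
  have hle := hη.trans (add_le_add_left (ENNReal.rpow_le_rpow hupdate (by positivity)) η)
  rw [← eLpNorm_restrict_rpow_add_compl (μ := μ) hp₀ hp _ hA,
    ← eLpNorm_restrict_rpow_add_compl (μ := μ) hp₀ hp
      (fun ω => f ω - Function.update y i z (κ ω)) hA,
    hon, hon, hoff, Function.update_self, add_right_comm] at hle
  have hrest : eLpNorm (fun ω => f ω - y (κ ω)) p (μ.restrict Aᶜ) ^ p.toReal ≠ ∞ :=
    ENNReal.rpow_ne_top_of_nonneg (by positivity)
      (ne_top_of_le_ne_top hcost (eLpNorm_mono_measure _ Measure.restrict_le_self))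
  have hpow := (ENNReal.add_le_add_iff_right hrest).1 hle
  calc _ = (eLpNorm (fun ω => f ω - y i) p (μ.restrict A) ^ p.toReal) ^ p.toReal⁻¹ :=
        (ENNReal.rpow_rpow_inv (by positivity) _).symm
    _ ≤ _ := ENNReal.rpow_le_rpow hpow (by positivity)
    _ ≤ _ := ENNReal.rpow_add_le_add_rpow _ _ (by positivity) (inv_le_one_of_one_le₀ hq)
    _ = _ := by rw [ENNReal.rpow_rpow_inv (by positivity)]

theorem eLpNorm_sub_le_add {ν : Measure Ω} (hp₁ : 1 ≤ p) {g h : Ω → X}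
    (hf : AEStronglyMeasurable f ν) (hg : AEStronglyMeasurable g ν)
    (hh : AEStronglyMeasurable h ν) :
    eLpNorm (fun ω => f ω - h ω) p ν ≤
      eLpNorm (fun ω => f ω - g ω) p ν + eLpNorm (fun ω => g ω - h ω) p ν :=
  (congrArg (eLpNorm · p ν) (sub_add_sub_cancel f g h).symm).trans_le
    (eLpNorm_add_le (hf.sub hg) (hg.sub hh) hp₁)

theorem eLpNorm_sub_const_le_of_enorm_le {ν : Measure Ω} (hp₁ : 1 ≤ p) (hp : p ≠ ∞)
    (hf : AEStronglyMeasurable f ν) {s : Ω → X} (hs : AEStronglyMeasurable s ν) {x y : X}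
    {ε : ℝ≥0∞} (h : ∀ ω, ‖s ω - y‖ₑ ≤ ‖s ω - x‖ₑ + ε) :
    eLpNorm (fun ω => f ω - y) p ν ≤ eLpNorm (fun ω => f ω - x) p ν +
      2 * eLpNorm (fun ω => f ω - s ω) p ν + ε * ν Set.univ ^ p.toReal⁻¹ := by
  have hxs := eLpNorm_sub_le_add hp₁ hs hf (aestronglyMeasurable_const (b := x))
  rw [show eLpNorm (fun ω => s ω - f ω) p ν = eLpNorm (fun ω => f ω - s ω) p ν from
    eLpNorm_sub_comm s f p ν] at hxs
  have hys : eLpNorm (fun ω => s ω - y) p ν ≤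
      eLpNorm (fun ω => s ω - x) p ν + ε * ν Set.univ ^ p.toReal⁻¹ := by
    have hmeas : AEStronglyMeasurable (fun ω => ‖s ω - x‖ₑ) ν :=
      (hs.sub aestronglyMeasurable_const).enorm.aestronglyMeasurable
    calc eLpNorm (fun ω => s ω - y) p ν
        ≤ eLpNorm ((fun ω => ‖s ω - x‖ₑ) + fun _ => ε) p ν :=
          eLpNorm_mono_enorm h
      _ ≤ eLpNorm (fun ω => ‖s ω - x‖ₑ) p ν + eLpNorm (fun _ => ε) p ν :=
          eLpNorm_add_le hmeas aestronglyMeasurable_const hp₁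
      _ = _ := by
        rw [eLpNorm_enorm, eLpNorm_const' _ (one_pos.trans_le hp₁).ne' hp, one_div, enorm_eq_self]
  calc eLpNorm (fun ω => f ω - y) p ν
      ≤ eLpNorm (fun ω => f ω - s ω) p ν + eLpNorm (fun ω => s ω - y) p ν :=
        eLpNorm_sub_le_add hp₁ hf hs aestronglyMeasurable_const
    _ ≤ eLpNorm (fun ω => f ω - s ω) p ν + (eLpNorm (fun ω => f ω - s ω) p ν +
          eLpNorm (fun ω => f ω - x) p ν + ε * ν Set.univ ^ p.toReal⁻¹) := by grw [hys, hxs]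
    _ = _ := by ring

end QuantError

section NearlyOptimalValues

variable {Ω : Type*} [MeasurableSpace Ω] {μ : Measure Ω} {X : Type*} [NormedAddCommGroup X]
  {p : ℝ≥0∞} {f : Ω → X} {A : ℕ → Set Ω} {x : ℕ → X} {η : ℕ → ℝ≥0∞} {a D : ℝ≥0∞}
  {s : ℕ → SimpleFunc Ω X}

theorem limsup_enorm_le_of_isNearBestConst (hp₁ : 1 ≤ p) (hp : p ≠ ∞) (hf : MemLp f p μ)
    (hη : Tendsto η atTop (𝓝 0))
    (hopt : ∀ n, IsNearBestConst f p (μ.restrict (A n)) (η n) (x n))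
    (hA : Tendsto (fun n => μ (A n)) atTop (𝓝 a)) (ha : a ≠ 0) :
    limsup (fun n => ‖x n‖ₑ) atTop ≤ 2 * eLpNorm f p μ / a ^ p.toReal⁻¹ := by
  have hp₀ : p ≠ 0 := (one_pos.trans_le hp₁).ne'
  have hq : 0 < p.toReal⁻¹ := inv_pos.2 (ENNReal.toReal_pos hp₀ hp)
  have hbound : ∀ n, ‖x n‖ₑ * μ (A n) ^ p.toReal⁻¹ ≤ 2 * eLpNorm f p μ + η n := fun n => by
    have hf_le : eLpNorm (fun ω => f ω - 0) p (μ.restrict (A n)) ≤ eLpNorm f p μ := by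
      simpa only [sub_zero] using eLpNorm_mono_measure f Measure.restrict_le_self
    have htri := eLpNorm_sub_le_add (ν := μ.restrict (A n)) (f := fun _ => x n) (h := fun _ => 0)
      hp₁ aestronglyMeasurable_const hf.1.restrict aestronglyMeasurable_const
    rw [show eLpNorm (fun ω => x n - f ω) p (μ.restrict (A n)) = _ from
      eLpNorm_sub_comm (fun _ => x n) f p _] at htri
    calc ‖x n‖ₑ * μ (A n) ^ p.toReal⁻¹
        = eLpNorm (fun _ => x n - 0) p (μ.restrict (A n)) := by
          rw [eLpNorm_const' _ hp₀ hp, Measure.restrict_apply_univ, one_div, sub_zero]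
      _ ≤ (eLpNorm f p μ + η n) + eLpNorm f p μ :=
          htri.trans (add_le_add ((hopt n 0).trans (by grw [hf_le])) hf_le)
      _ = 2 * eLpNorm f p μ + η n := by ring
  have hlim : Tendsto (fun n => (2 * eLpNorm f p μ + η n) / μ (A n) ^ p.toReal⁻¹) atTop
      (𝓝 (2 * eLpNorm f p μ / a ^ p.toReal⁻¹)) := by
    have hroot := (ENNReal.continuous_rpow_const (y := p.toReal⁻¹)).tendsto a |>.comp hA
    have htwo : 2 * eLpNorm f p μ ≠ ∞ := by finiteness [hf.2.ne]
    refine ENNReal.Tendsto.div (by simpa only [add_zero] using hη.const_add _) (.inr ?_) hroot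
      (.inr htwo)
    simp [ha, hq]
  refine (limsup_le_limsup ?_).trans_eq hlim.limsup_eq
  filter_upwards [hA.eventually_ne ha, hη.eventually_ne ENNReal.zero_ne_top] with n hAn hηn
  exact (ENNReal.le_div_iff_mul_le (.inl (by simp [hAn])) (.inr (by finiteness [hf.2.ne]))).2
    (hbound n)

theorem eventually_forall_enorm_sub_le_add (s : SimpleFunc Ω X)
    (hdist : ∀ ω, ∃ L ≠ ∞, Tendsto (fun n => ‖s ω - x n‖ₑ) atTop (𝓝 L)) {ε : ℝ≥0∞} (hε : 0 < ε) :
    ∀ᶠ nm : ℕ × ℕ in atTop ×ˢ atTop, ∀ ω, ‖s ω - x nm.2‖ₑ ≤ ‖s ω - x nm.1‖ₑ + ε := by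
  have hvalue : ∀ y ∈ Set.range s, ∀ᶠ nm : ℕ × ℕ in atTop ×ˢ atTop,
      ‖y - x nm.2‖ₑ ≤ ‖y - x nm.1‖ₑ + ε := by
    rintro _ ⟨ω, rfl⟩
    obtain ⟨L, hL, hlim⟩ := hdist ω
    have hnear := (ENNReal.tendsto_nhds hL).1 hlim (ε / 2) (ENNReal.half_pos hε.ne')
    refine (hnear.prod_mk hnear).mono fun nm ⟨hn, hm⟩ => ?_
    calc ‖s ω - x nm.2‖ₑ ≤ L + ε / 2 := hm.2
      _ ≤ ‖s ω - x nm.1‖ₑ + ε / 2 + ε / 2 := by grw [tsub_le_iff_right.1 hn.1]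
      _ = ‖s ω - x nm.1‖ₑ + ε := by rw [add_assoc, ENNReal.add_halves]
  exact ((s.finite_range.eventually_all).2 hvalue).mono fun nm h ω => h _ ⟨ω, rfl⟩

theorem limsup_eLpNorm_sub_const_le (hp₁ : 1 ≤ p) (hp : p ≠ ∞) (hf : AEStronglyMeasurable f μ)
    (hA : Tendsto (fun n => μ (A n)) atTop (𝓝 a))
    (hD : Tendsto (fun n => eLpNorm (fun ω => f ω - x n) p (μ.restrict (A n))) atTop (𝓝 D))
    {s : SimpleFunc Ω X} {ε : ℝ≥0∞} (hε : 0 < ε) (hε_top : ε ≠ ∞)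
    (hs : eLpNorm (fun ω => f ω - s ω) p μ ≤ ε)
    (hdist : ∀ ω, ∃ L ≠ ∞, Tendsto (fun n => ‖s ω - x n‖ₑ) atTop (𝓝 L)) :
    limsup (fun nm : ℕ × ℕ => eLpNorm (fun ω => f ω - x nm.2) p (μ.restrict (A nm.1)))
      (atTop ×ˢ atTop) ≤ D + 2 * ε + ε * a ^ p.toReal⁻¹ := by
  have hfst : Tendsto Prod.fst (atTop ×ˢ (atTop : Filter ℕ)) (atTop : Filter ℕ) := tendsto_fst
  have hlim := ((hD.comp hfst).add_const (2 * ε)).add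
    (ENNReal.Tendsto.const_mul (a := ε) ((hA.ennrpow_const p.toReal⁻¹).comp hfst) (.inr hε_top))
  refine (limsup_le_limsup ?_).trans_eq hlim.limsup_eq
  filter_upwards [eventually_forall_enorm_sub_le_add s hdist hε] with nm hnm
  have hle := eLpNorm_sub_const_le_of_enorm_le (ν := μ.restrict (A nm.1)) hp₁ hp hf.restrict
    s.aestronglyMeasurable hnm
  rw [Measure.restrict_apply_univ] at hle
  refine hle.trans ?_
  grw [eLpNorm_mono_measure (fun ω => f ω - s ω) Measure.restrict_le_self, hs]
  rfl

theorem tendsto_eLpNorm_sub_const_of_isNearBestConst (hp₁ : 1 ≤ p) (hp : p ≠ ∞)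
    (hf : AEStronglyMeasurable f μ) (hη : Tendsto η atTop (𝓝 0))
    (hopt : ∀ n, IsNearBestConst f p (μ.restrict (A n)) (η n) (x n))
    (hA : Tendsto (fun n => μ (A n)) atTop (𝓝 a)) (ha : a ≠ ∞)
    (hD : Tendsto (fun n => eLpNorm (fun ω => f ω - x n) p (μ.restrict (A n))) atTop (𝓝 D))
    (hs : ∀ ε : ℝ≥0∞, 0 < ε → ∃ j, eLpNorm (fun ω => f ω - s j ω) p μ ≤ ε)
    (hdist : ∀ j ω, ∃ L ≠ ∞, Tendsto (fun n => ‖s j ω - x n‖ₑ) atTop (𝓝 L)) :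
    Tendsto (fun nm : ℕ × ℕ => eLpNorm (fun ω => f ω - x nm.2) p (μ.restrict (A nm.1)))
      (atTop ×ˢ atTop) (𝓝 D) := by
  have hlower : D ≤ liminf (fun nm : ℕ × ℕ =>
      eLpNorm (fun ω => f ω - x nm.2) p (μ.restrict (A nm.1))) (atTop ×ˢ atTop) := by
    have hsub := (ENNReal.Tendsto.sub hD hη (.inr ENNReal.zero_ne_top)).comp
      (tendsto_fst (f := atTop) (g := (atTop : Filter ℕ)))
    rw [tsub_zero] at hsub
    exact hsub.liminf_eq.ge.trans (liminf_le_liminf (.of_forall fun nm =>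
      tsub_le_iff_right.2 (hopt nm.1 (x nm.2))))
  refine tendsto_of_le_liminf_of_limsup_le hlower ?_
  have hbound : Tendsto (fun ε => D + 2 * ε + ε * a ^ p.toReal⁻¹) (𝓝[>] 0) (𝓝 D) := by
    have hid : Tendsto (fun ε : ℝ≥0∞ => ε) (𝓝[>] 0) (𝓝 0) := nhdsWithin_le_nhds
    simpa only [mul_zero, zero_mul, add_zero] using
      ((ENNReal.Tendsto.const_mul hid (.inr ENNReal.ofNat_ne_top)).const_add D).add
        (ENNReal.Tendsto.mul_const hid (.inr (by finiteness)))
  refine ge_of_tendsto hbound ?_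
  filter_upwards [self_mem_nhdsWithin, mem_nhdsWithin_of_mem_nhds
    (Iio_mem_nhds ENNReal.zero_lt_top)] with ε hε hε_top
  obtain ⟨j, hj⟩ := hs ε hε
  exact limsup_eLpNorm_sub_const_le hp₁ hp hf hA hD hε hε_top.ne hj (hdist j)

theorem exists_tendsto_of_tendsto_eLpNorm_const_sub [CompleteSpace X] (hp₀ : p ≠ 0) (hp : p ≠ ∞)
    (hA : Tendsto (fun n => μ (A n)) atTop (𝓝 a)) (ha₀ : a ≠ 0) (ha : a ≠ ∞)
    (hx : Tendsto (fun nm : ℕ × ℕ => eLpNorm (fun _ => x nm.2 - x nm.1) p (μ.restrict (A nm.1)))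
      (atTop ×ˢ atTop) (𝓝 0)) :
    ∃ b, Tendsto x atTop (𝓝 b) := by
  have hq : 0 < p.toReal⁻¹ := inv_pos.2 (ENNReal.toReal_pos hp₀ hp)
  have hA' : Tendsto (fun nm : ℕ × ℕ => μ (A nm.1)) (atTop ×ˢ atTop) (𝓝 a) := hA.comp tendsto_fst
  have hroot : Tendsto (fun nm : ℕ × ℕ => μ (A nm.1) ^ p.toReal⁻¹) (atTop ×ˢ atTop)
      (𝓝 (a ^ p.toReal⁻¹)) := (ENNReal.continuous_rpow_const.tendsto a).comp hA'
  have hedist : Tendsto (fun nm : ℕ × ℕ => ‖x nm.2 - x nm.1‖ₑ) (atTop ×ˢ atTop) (𝓝 0) := by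
    have hdiv := ENNReal.Tendsto.div hx (.inr (by simp [ha₀, ha])) hroot
      (.inr ENNReal.zero_ne_top)
    rw [ENNReal.zero_div] at hdiv
    refine hdiv.congr' ?_
    filter_upwards [hA'.eventually_ne ha₀, hA'.eventually_ne ha] with nm h₀ h_top
    rw [eLpNorm_const' _ hp₀ hp, Measure.restrict_apply_univ, one_div]
    exact ENNReal.mul_div_cancel_right (ENNReal.rpow_pos (pos_iff_ne_zero.2 h₀) h_top).ne'
      (ENNReal.rpow_ne_top_of_nonneg hq.le h_top)
  refine cauchySeq_tendsto_of_complete (cauchySeq_iff_tendsto_dist_atTop_0.2 ?_)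
  rw [← prod_atTop_atTop_eq]
  simpa only [dist_eq_norm', norm_zero] using (tendsto_zero_iff_enorm_tendsto_zero.2 hedist).norm

theorem exists_tendsto_of_isNearBestConst [NormedSpace ℝ X] [UniformConvexSpace X]
    [CompleteSpace X] (hp₁ : 1 < p) (hp : p ≠ ∞) (hf : MemLp f p μ) (hη : Tendsto η atTop (𝓝 0))
    (hopt : ∀ n, IsNearBestConst f p (μ.restrict (A n)) (η n) (x n))
    (hA : Tendsto (fun n => μ (A n)) atTop (𝓝 a)) (ha₀ : a ≠ 0) (ha : a ≠ ∞)
    (hD : Tendsto (fun n => eLpNorm (fun ω => f ω - x n) p (μ.restrict (A n))) atTop (𝓝 D))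
    (hs : ∀ ε : ℝ≥0∞, 0 < ε → ∃ j, eLpNorm (fun ω => f ω - s j ω) p μ ≤ ε)
    (hdist : ∀ j ω, ∃ L ≠ ∞, Tendsto (fun n => ‖s j ω - x n‖ₑ) atTop (𝓝 L)) :
    ∃ b, Tendsto x atTop (𝓝 b) := by
  have hD_top : D ≠ ∞ := by
    refine ne_top_of_le_ne_top hf.2.ne (le_of_tendsto_of_tendsto' hD
      (by simpa only [add_zero] using hη.const_add (eLpNorm f p μ)) fun n => (hopt n 0).trans ?_)
    simp only [sub_zero]
    grw [eLpNorm_mono_measure _ Measure.restrict_le_self]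
  have hfst : Tendsto Prod.fst (atTop ×ˢ (atTop : Filter ℕ)) (atTop : Filter ℕ) := tendsto_fst
  have hmid : D ≤ liminf (fun nm : ℕ × ℕ => eLpNorm ((2⁻¹ : ℝ) •
      ((fun ω => f ω - x nm.1) + fun ω => f ω - x nm.2)) p (μ.restrict (A nm.1)))
      (atTop ×ˢ atTop) := by
    have hsub := (ENNReal.Tendsto.sub hD hη (.inr ENNReal.zero_ne_top)).comp hfst
    rw [tsub_zero] at hsub
    refine hsub.liminf_eq.ge.trans (liminf_le_liminf (.of_forall fun nm =>
      tsub_le_iff_right.2 ((hopt nm.1 ((2⁻¹ : ℝ) • (x nm.1 + x nm.2))).trans_eq ?_)))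
    congr 2
    ext ω
    simp only [Pi.smul_apply, Pi.add_apply]
    module
  have hdiff := tendsto_eLpNorm_sub_zero_of_midpoint hp₁ hp
    (ν := fun nm => μ.restrict (A nm.1)) (F := fun (nm : ℕ × ℕ) ω => f ω - x nm.1)
    (G := fun nm ω => f ω - x nm.2) (fun nm => (hf.1.sub aestronglyMeasurable_const).restrict)
    (fun nm => (hf.1.sub aestronglyMeasurable_const).restrict) hD_top (hD.comp hfst)
    (tendsto_eLpNorm_sub_const_of_isNearBestConst hp₁.le hp hf.1 hη hopt hA ha hD hs hdist) hmid
  refine exists_tendsto_of_tendsto_eLpNorm_const_sub (one_pos.trans hp₁).ne' hp hA ha₀ ha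
    (hdiff.congr fun nm => congrArg (eLpNorm · p (μ.restrict (A nm.1))) ?_)
  ext ω
  exact sub_sub_sub_cancel_left _ _ _

theorem exists_tendsto_or_tendsto_measure_zero [NormedSpace ℝ X] [UniformConvexSpace X]
    [CompleteSpace X] (hp₁ : 1 < p) (hp : p ≠ ∞) (hf : MemLp f p μ) (hη : Tendsto η atTop (𝓝 0))
    (hopt : ∀ n, IsNearBestConst f p (μ.restrict (A n)) (η n) (x n))
    (hA : Tendsto (fun n => μ (A n)) atTop (𝓝 a))
    (hD : Tendsto (fun n => eLpNorm (fun ω => f ω - x n) p (μ.restrict (A n))) atTop (𝓝 D))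
    (hs : ∀ ε : ℝ≥0∞, 0 < ε → ∃ j, eLpNorm (fun ω => f ω - s j ω) p μ ≤ ε)
    (hdist : ∀ j ω, ∃ L, Tendsto (fun n => ‖s j ω - x n‖ₑ) atTop (𝓝 L)) :
    a = 0 ∨ ∃ b, Tendsto x atTop (𝓝 b) := by
  refine or_iff_not_imp_left.2 fun ha₀ => ?_
  have hq : 0 < p.toReal⁻¹ := inv_pos.2 (ENNReal.toReal_pos (one_pos.trans hp₁).ne' hp)
  have hlimsup := limsup_enorm_le_of_isNearBestConst hp₁.le hp hf hη hopt hA ha₀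
  by_cases ha : a = ∞
  · rw [ha, ENNReal.top_rpow_of_pos hq, ENNReal.div_top] at hlimsup
    exact ⟨0, tendsto_zero_iff_enorm_tendsto_zero.2
      (tendsto_of_le_liminf_of_limsup_le bot_le hlimsup)⟩
  have hbound : 2 * eLpNorm f p μ / a ^ p.toReal⁻¹ < ∞ :=
    ENNReal.div_lt_top (by finiteness [hf.2.ne]) (by simp [ha₀, ha])
  obtain ⟨M, hM, hM_top⟩ := exists_between (hlimsup.trans_lt hbound)
  refine exists_tendsto_of_isNearBestConst hp₁ hp hf hη hopt hA ha₀ ha hD hs fun j ω => ?_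
  obtain ⟨L, hL⟩ := hdist j ω
  have hL_le : L ≤ ‖s j ω‖ₑ + M := le_of_tendsto hL <|
    (eventually_lt_of_limsup_lt hM).mono fun n hn => enorm_sub_le.trans (by grw [hn])
  exact ⟨L, ne_top_of_le_ne_top (by finiteness [hM_top.ne]) hL_le, hL⟩

end NearlyOptimalValues

theorem exists_subseq_forall_tendsto {J Y : Type*} [Countable J] [TopologicalSpace Y]
    [CompactSpace Y] [FirstCountableTopology Y] (u : J → ℕ → Y) :
    ∃ φ : ℕ → ℕ, StrictMono φ ∧ ∀ j, ∃ L, Tendsto (fun n => u j (φ n)) atTop (𝓝 L) := by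
  obtain ⟨L, φ, hφ, hlim⟩ := CompactSpace.tendsto_subseq fun n j => u j n
  exact ⟨φ, hφ, fun j => ⟨L j, tendsto_pi_nhds.1 hlim j⟩⟩

section LabelSubsequence

variable {Ω : Type*} [MeasurableSpace Ω] {μ : Measure Ω} {X : Type*} [NormedAddCommGroup X]
  {ι : Type*} [MeasurableSpace ι] {p : ℝ≥0∞} {f : Ω → X}

theorem exists_simpleFunc_seq_eLpNorm_sub_le (hp : p ≠ ∞) (hf : MemLp f p μ) :
    ∃ s : ℕ → SimpleFunc Ω X, ∀ ε : ℝ≥0∞, 0 < ε →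
      ∃ j, eLpNorm (fun ω => f ω - s j ω) p μ ≤ ε := by
  choose s hs using fun j : ℕ => hf.exists_simpleFunc_eLpNorm_sub_lt hp
    (ENNReal.inv_ne_zero.2 (ENNReal.natCast_ne_top j))
  refine ⟨s, fun ε hε => ?_⟩
  obtain ⟨j, hj⟩ := ENNReal.exists_inv_nat_lt hε.ne'
  exact ⟨j, ((hs j).1.trans hj).le⟩

theorem tendsto_rpow_sub_rpow_rpow_inv_zero {cost : ℕ → ℝ≥0∞} {D : ℝ≥0∞} (hD : D ≠ ∞) {q : ℝ}
    (hq : 0 < q) (hcost : Tendsto cost atTop (𝓝 D)) :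
    Tendsto (fun n => (cost n ^ q - D ^ q) ^ q⁻¹) atTop (𝓝 0) := by
  have hpow := (ENNReal.continuous_rpow_const (y := q)).tendsto D |>.comp hcost
  have hsub := ENNReal.Tendsto.sub hpow (tendsto_const_nhds (x := D ^ q))
    (.inr (ENNReal.rpow_ne_top_of_nonneg hq.le hD))
  have hroot := (ENNReal.continuous_rpow_const (y := q⁻¹)).tendsto 0
  rw [ENNReal.zero_rpow_of_pos (inv_pos.2 hq)] at hroot
  rw [tsub_self] at hsub
  exact hroot.comp hsub

theorem exists_subseq_measure_fiber_tendsto_zero_or_tendsto [Finite ι]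
    [MeasurableSingletonClass ι] [Nonempty ι] [NormedSpace ℝ X] [UniformConvexSpace X]
    [CompleteSpace X] (hp₁ : 1 < p) (hp : p ≠ ∞) (hf : MemLp f p μ) {κ : ℕ → Ω → ι}
    {x : ℕ → ι → X} (hκ : ∀ n, Measurable (κ n))
    (hcost : ∀ n, eLpNorm (fun ω => f ω - x n (κ n ω)) p μ ≠ ∞)
    (hmin : Tendsto (fun n => eLpNorm (fun ω => f ω - x n (κ n ω)) p μ) atTop
      (𝓝 (quantError ι f p μ))) :
    ∃ φ : ℕ → ℕ, StrictMono φ ∧ ∀ i, Tendsto (fun n => μ (κ (φ n) ⁻¹' {i})) atTop (𝓝 0) ∨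
      ∃ b, Tendsto (fun n => x (φ n) i) atTop (𝓝 b) := by
  have hq : 0 < p.toReal := ENNReal.toReal_pos (one_pos.trans hp₁).ne' hp
  obtain ⟨s, hs⟩ := exists_simpleFunc_seq_eLpNorm_sub_le hp hf
  let S : Set X := ⋃ j, Set.range (s j)
  have : Countable S := (Set.countable_iUnion fun j => (s j).finite_range.countable).to_subtype
  obtain ⟨φ, hφ, hlim⟩ := exists_subseq_forall_tendsto (J := ι ⊕ ι ⊕ S × ι)
    (Sum.elim (fun i n => μ (κ n ⁻¹' {i})) (Sum.elim
      (fun i n => eLpNorm (fun ω => f ω - x n i) p (μ.restrict (κ n ⁻¹' {i})))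
      (fun yi n => ‖(yi.1 : X) - x n yi.2‖ₑ)))
  refine ⟨φ, hφ, fun i => ?_⟩
  obtain ⟨a, ha⟩ := hlim (.inl i)
  obtain ⟨D, hD⟩ := hlim (.inr (.inl i))
  have hη := (tendsto_rpow_sub_rpow_rpow_inv_zero (quantError_ne_top hf) hq hmin).comp
    hφ.tendsto_atTop
  rcases exists_tendsto_or_tendsto_measure_zero hp₁ hp hf hη
    (fun n => isNearBestConst_restrict_fiber hp₁.le hp (hκ (φ n)) le_add_tsub (hcost _) i) ha hD hs
    (fun j ω => hlim (.inr (.inr (⟨s j ω, Set.mem_iUnion.2 ⟨j, ω, rfl⟩⟩, i)))) with rfl | hb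
  · exact .inl ha
  · exact .inr hb

end LabelSubsequence

section Stationarity

variable {Ω : Type*} [MeasurableSpace Ω] {μ : Measure Ω} {φ : Ω → ℝ → ℝ}

theorem abs_slope_le_of_convexOn {φ : ℝ → ℝ} (hφ : ConvexOn ℝ Set.univ φ) {x t : ℝ} (ht : t ≠ x)
    (ht' : t ∈ Set.Icc (x - 1) (x + 1)) :
    |slope φ x t| ≤ |φ (x - 1) - φ x| + |φ (x + 1) - φ x| := by
  have hmono := hφ.slope_mono (Set.mem_univ x)
  have hlower := hmono (a := x - 1) (b := t) (by simp) (by simpa using ht) ht'.1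
  have hupper := hmono (a := t) (b := x + 1) (by simpa using ht) (by simp) ht'.2
  simp only [slope_def_field, sub_sub_cancel_left, add_sub_cancel_left, div_one, div_neg] at *
  rw [abs_le]
  constructor
  · linarith [le_abs_self (φ (x - 1) - φ x), abs_nonneg (φ (x + 1) - φ x)]
  · linarith [le_abs_self (φ (x + 1) - φ x), abs_nonneg (φ (x - 1) - φ x)]

theorem hasDerivAt_integral_of_convexOn {x : ℝ} (hconv : ∀ ω, ConvexOn ℝ Set.univ (φ ω))
    (hint : ∀ t, Integrable (φ · t) μ) (hdiff : ∀ ω, DifferentiableAt ℝ (φ ω) x) :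
    HasDerivAt (fun t => ∫ ω, φ ω t ∂μ) (∫ ω, deriv (φ ω) x ∂μ) x := by
  have hslope : ∀ t, Integrable (fun ω => slope (φ ω) x t) μ := fun t =>
    ((hint t).sub (hint x)).const_mul _
  rw [hasDerivAt_iff_tendsto_slope]
  have hlim : Tendsto (fun t => ∫ ω, slope (φ ω) x t ∂μ) (𝓝[≠] x) (𝓝 (∫ ω, deriv (φ ω) x ∂μ)) := by
    refine tendsto_integral_filter_of_dominated_convergence
      (fun ω => |φ ω (x - 1) - φ ω x| + |φ ω (x + 1) - φ ω x|)
      (.of_forall fun t => (hslope t).1) ?_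
      (((hint _).sub (hint x)).abs.add ((hint _).sub (hint x)).abs)
      (.of_forall fun ω => (hasDerivAt_iff_tendsto_slope.1 (hdiff ω).hasDerivAt))
    filter_upwards [self_mem_nhdsWithin, mem_nhdsWithin_of_mem_nhds
      (Icc_mem_nhds (sub_one_lt x) (lt_add_one x))] with t ht ht'
    exact .of_forall fun ω => abs_slope_le_of_convexOn (hconv ω) ht ht'
  refine hlim.congr fun t => ?_
  simp only [slope_def_field]
  rw [integral_div, integral_sub (hint t) (hint x)]

theorem convexOn_integral (hconv : ∀ ω, ConvexOn ℝ Set.univ (φ ω))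
    (hint : ∀ t, Integrable (φ · t) μ) : ConvexOn ℝ Set.univ fun t => ∫ ω, φ ω t ∂μ := by
  refine ⟨convex_univ, fun s _ t _ a b ha hb hab => ?_⟩
  have hs := (hint s).smul a
  have ht := (hint t).smul b
  calc ∫ ω, φ ω (a • s + b • t) ∂μ ≤ ∫ ω, a • φ ω s + b • φ ω t ∂μ :=
        integral_mono (hint _) (hs.add ht) fun ω =>
          (hconv ω).2 (Set.mem_univ s) (Set.mem_univ t) ha hb hab
    _ = a • ∫ ω, φ ω s ∂μ + b • ∫ ω, φ ω t ∂μ := by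
        rw [← integral_smul, ← integral_smul]
        exact integral_add hs ht

variable {X : Type*} [NormedAddCommGroup X] {p : ℝ≥0∞} {f : Ω → X} {x : X}

theorem eLpNorm_le_eLpNorm_iff_integral_norm_rpow_le (hp₀ : p ≠ 0) (hp : p ≠ ∞) {F G : Ω → X}
    (hF : MemLp F p μ) (hG : MemLp G p μ) :
    eLpNorm F p μ ≤ eLpNorm G p μ ↔ ∫ ω, ‖F ω‖ ^ p.toReal ∂μ ≤ ∫ ω, ‖G ω‖ ^ p.toReal ∂μ := by
  have hint : ∀ H : Ω → X, 0 ≤ ∫ ω, ‖H ω‖ ^ p.toReal ∂μ := fun H =>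
    integral_nonneg fun ω => by positivity
  rw [hF.eLpNorm_eq_integral_rpow_norm hp₀ hp, hG.eLpNorm_eq_integral_rpow_norm hp₀ hp,
    ENNReal.ofReal_le_ofReal_iff (Real.rpow_nonneg (hint G) _),
    Real.rpow_le_rpow_iff (hint F) (hint G) (inv_pos.2 (ENNReal.toReal_pos hp₀ hp))]

variable [NormedSpace ℝ X]

theorem convexOn_norm_sub_lineMap_rpow {q : ℝ} (hq : 1 ≤ q) (u x z : X) :
    ConvexOn ℝ Set.univ fun t : ℝ => ‖u - AffineMap.lineMap x z t‖ ^ q := by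
  have h := (convexOn_norm_rpow (X := X) hq).comp_affineMap (AffineMap.lineMap (u - x) (u - z))
  rw [Set.preimage_univ] at h
  refine h.congr fun t _ => ?_
  simp only [Function.comp_apply, AffineMap.lineMap_apply_module]
  congr 2
  module

theorem GateauxDifferentiableNorm.differentiableAt_norm_sub_lineMap_rpow
    (hX : GateauxDifferentiableNorm X) {q : ℝ} (hq : 1 < q) (u x z : X) :
    DifferentiableAt ℝ (fun t : ℝ => ‖u - AffineMap.lineMap x z t‖ ^ q) 0 := by
  have hline : ∀ t : ℝ, u - AffineMap.lineMap x z t = u - x + t • (x - z) := fun t => by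
    rw [AffineMap.lineMap_apply_module]
    module
  simp only [hline]
  rcases eq_or_ne (u - x) 0 with h₀ | h₀
  · simp only [h₀, zero_add, norm_smul, Real.norm_eq_abs,
      Real.mul_rpow (abs_nonneg _) (norm_nonneg _)]
    exact ((hasDerivAt_abs_rpow 0 hq).mul_const _).differentiableAt
  · have h : DifferentiableAt ℝ (fun t : ℝ => ‖u - x + t • (x - z)‖) 0 := hX _ h₀ _
    exact h.rpow_const (.inl (by simpa using h₀))

theorem GateauxDifferentiableNorm.hasDerivAt_integral_of_isBestConst
    (hX : GateauxDifferentiableNorm X) (hp₁ : 1 < p) (hp : p ≠ ∞) [IsFiniteMeasure μ]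
    (hf : MemLp f p μ)
    (hx : IsBestConst f p μ x) (z : X) :
    HasDerivAt (fun t : ℝ => ∫ ω, ‖f ω - AffineMap.lineMap x z t‖ ^ p.toReal ∂μ) 0 0 := by
  have hp₀ : p ≠ 0 := (one_pos.trans hp₁).ne'
  have hq : 1 < p.toReal := by
    simpa using (ENNReal.toReal_lt_toReal ENNReal.one_ne_top hp).2 hp₁
  have hLp : ∀ w, MemLp (fun ω => f ω - w) p μ := fun w => hf.sub (memLp_const w)
  have hderiv := hasDerivAt_integral_of_convexOn (μ := μ) (x := 0)
    (fun ω => convexOn_norm_sub_lineMap_rpow hq.le (f ω) x z)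
    (fun t => (hLp _).integrable_norm_rpow hp₀ hp)
    (fun ω => hX.differentiableAt_norm_sub_lineMap_rpow hq (f ω) x z)
  have hmin : IsLocalMin (fun t : ℝ => ∫ ω, ‖f ω - AffineMap.lineMap x z t‖ ^ p.toReal ∂μ) 0 :=
    .of_forall fun t => by
      simpa only [AffineMap.lineMap_apply_zero] using
        (eLpNorm_le_eLpNorm_iff_integral_norm_rpow_le hp₀ hp (hLp x) (hLp _)).1 (hx _)
  rwa [hmin.hasDerivAt_eq_zero hderiv] at hderiv

theorem GateauxDifferentiableNorm.isBestConst_restrict_of_compl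
    (hX : GateauxDifferentiableNorm X) (hp₁ : 1 < p) (hp : p ≠ ∞) [IsFiniteMeasure μ]
    (hf : MemLp f p μ) {B : Set Ω} (hB : MeasurableSet B)
    (hx : IsBestConst f p μ x)
    (hxB : IsBestConst f p (μ.restrict Bᶜ) x) :
    IsBestConst f p (μ.restrict B) x := by
  intro z
  have hp₀ : p ≠ 0 := (one_pos.trans hp₁).ne'
  have hq : 1 < p.toReal := by
    simpa using (ENNReal.toReal_lt_toReal ENNReal.one_ne_top hp).2 hp₁
  have hLp : ∀ w, MemLp (fun ω => f ω - w) p μ := fun w => hf.sub (memLp_const w)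
  have hint : ∀ w, Integrable (fun ω => ‖f ω - w‖ ^ p.toReal) μ := fun w =>
    (hLp w).integrable_norm_rpow hp₀ hp
  have hderiv : HasDerivAt (fun t : ℝ =>
      ∫ ω in B, ‖f ω - AffineMap.lineMap x z t‖ ^ p.toReal ∂μ) 0 0 := by
    have h := (hX.hasDerivAt_integral_of_isBestConst hp₁ hp hf hx z).sub
      (hX.hasDerivAt_integral_of_isBestConst hp₁ hp (hf.restrict _) hxB z)
    rw [sub_zero] at h
    exact h.congr_of_eventuallyEq <| .of_forall fun t =>
      eq_sub_of_add_eq (integral_add_compl hB (hint _))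
  have hconv := convexOn_integral (μ := μ.restrict B)
    (fun ω => convexOn_norm_sub_lineMap_rpow hq.le (f ω) x z) fun t => (hint _).restrict
  have hle := hconv.le_slope_of_hasDerivAt (Set.mem_univ 0) (Set.mem_univ 1) one_pos hderiv
  rw [slope_def_field, sub_zero, div_one, AffineMap.lineMap_apply_zero,
    AffineMap.lineMap_apply_one, sub_nonneg] at hle
  exact (eLpNorm_le_eLpNorm_iff_integral_norm_rpow_le hp₀ hp ((hLp x).restrict B)
    ((hLp z).restrict B)).2 hle

end Stationarity

section BestConstants

variable {Ω : Type*} [MeasurableSpace Ω] {μ : Measure Ω} {X : Type*} [NormedAddCommGroup X]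
  {p : ℝ≥0∞} {f : Ω → X} {x : X}

theorem ae_norm_sub_le_of_forall_isBestConst (hp₀ : p ≠ 0) (hp : p ≠ ∞) [IsFiniteMeasure μ]
    (hf : MemLp f p μ)
    (hx : ∀ E, MeasurableSet E → IsBestConst f p (μ.restrict E) x) (z : X) :
    ∀ᵐ ω ∂μ, ‖f ω - x‖ ≤ ‖f ω - z‖ := by
  have hint : ∀ w, Integrable (fun ω => ‖f ω - w‖ ^ p.toReal) μ := fun w =>
    (hf.sub (memLp_const w)).integrable_norm_rpow hp₀ hp
  have hle := ae_le_of_forall_setIntegral_le (hint x) (hint z) fun E hE _ =>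
    (eLpNorm_le_eLpNorm_iff_integral_norm_rpow_le hp₀ hp ((hf.sub (memLp_const x)).restrict E)
      ((hf.sub (memLp_const z)).restrict E)).1 (hx E hE z)
  filter_upwards [hle] with ω hω
  exact (Real.rpow_le_rpow_iff (norm_nonneg _) (norm_nonneg _) (ENNReal.toReal_pos hp₀ hp)).1 hω

theorem ae_eq_of_forall_isBestConst (hp₀ : p ≠ 0) (hp : p ≠ ∞) [IsFiniteMeasure μ]
    (hfm : StronglyMeasurable f) (hf : MemLp f p μ)
    (hx : ∀ E, MeasurableSet E → IsBestConst f p (μ.restrict E) x) :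
    ∀ᵐ ω ∂μ, f ω = x := by
  obtain ⟨c, hc, hfc⟩ := hfm.isSeparable_range
  filter_upwards [(ae_ball_iff hc).2 fun z _ =>
    ae_norm_sub_le_of_forall_isBestConst hp₀ hp hf hx z] with ω hω
  refine sub_eq_zero.1 (norm_le_zero_iff.1 (le_of_forall_pos_le_add fun ε hε => ?_))
  obtain ⟨z, hz, hωz⟩ := Metric.mem_closure_iff.1 (hfc (Set.mem_range_self ω)) ε hε
  rw [dist_eq_norm] at hωz
  exact (hω z hz).trans (by linarith)

end BestConstants

section Ties

variable {Ω : Type*} [MeasurableSpace Ω] {μ : Measure Ω} {X : Type*} [NormedAddCommGroup X]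
  {ι : Type*} {p : ℝ≥0∞} {f : Ω → X} {κ : Ω → ι} {y : ι → X} {E : Set Ω} {i j : ι}

theorem measurableSet_norm_sub_eq (hfm : StronglyMeasurable f) (x z : X) :
    MeasurableSet {ω | ‖f ω - x‖ = ‖f ω - z‖} :=
  measurableSet_eq_fun (hfm.sub stronglyMeasurable_const).norm.measurable
    (hfm.sub stronglyMeasurable_const).norm.measurable

theorem eLpNorm_sub_comp_piecewise [DecidablePred (· ∈ E)]
    (hE : ∀ ω ∈ E, ‖f ω - y j‖ = ‖f ω - y (κ ω)‖) :
    eLpNorm (fun ω => f ω - y (E.piecewise (fun _ => j) κ ω)) p μ =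
      eLpNorm (fun ω => f ω - y (κ ω)) p μ :=
  eLpNorm_congr_norm_ae <| .of_forall fun ω => by
    by_cases hω : ω ∈ E
    · simp only [E.piecewise_eq_of_mem _ _ hω, hE ω hω]
    · simp only [E.piecewise_eq_of_notMem _ _ hω]

variable [MeasurableSpace ι]

theorem isBestConst_restrict_fiber [MeasurableSingletonClass ι] [Nonempty ι]
    (hp₁ : 1 ≤ p) (hp : p ≠ ∞) (hf : MemLp f p μ) (hκ : Measurable κ)
    (hopt : eLpNorm (fun ω => f ω - y (κ ω)) p μ = quantError ι f p μ) (i : ι) :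
    IsBestConst f p (μ.restrict (κ ⁻¹' {i})) (y i) := by
  have hroot : (0 : ℝ≥0∞) ^ p.toReal⁻¹ = 0 :=
    ENNReal.zero_rpow_of_pos (inv_pos.2 (ENNReal.toReal_pos (one_pos.trans_le hp₁).ne' hp))
  intro z
  simpa only [hroot, add_zero] using isNearBestConst_restrict_fiber (η := 0) hp₁ hp hκ
    (by rw [hopt, add_zero]) (hopt.trans_ne (quantError_ne_top hf)) i z

theorem measure_fiber_ne_top [MeasurableSingletonClass ι] (hp₀ : p ≠ 0) (hp : p ≠ ∞)
    (hκ : Measurable κ) (hy : MemLp (fun ω => y (κ ω)) p μ) (hi : y i ≠ 0) :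
    μ (κ ⁻¹' {i}) ≠ ∞ := by
  have hconst : MemLp (fun _ => y i) p (μ.restrict (κ ⁻¹' {i})) :=
    (hy.restrict _).ae_eq <| (ae_restrict_mem (hκ (measurableSet_singleton i))).mono
      fun ω hω => congrArg y hω
  simpa using (((memLp_const_iff hp₀ hp).1 hconst).resolve_left hi).ne

variable [NormedSpace ℝ X] [Finite ι] [MeasurableSingletonClass ι] [Nonempty ι]

/- Relabelling `E` from `i` to `j` keeps the cost, so `y i` is optimal both on the fiber of `i` and
on this fiber without `E`; smoothness transfers optimality to the difference `E`. -/
theorem GateauxDifferentiableNorm.isBestConst_restrict_of_tie (hX : GateauxDifferentiableNorm X)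
    (hp₁ : 1 < p) (hp : p ≠ ∞) (hf : MemLp f p μ) (hκ : Measurable κ)
    (hopt : eLpNorm (fun ω => f ω - y (κ ω)) p μ = quantError ι f p μ) (hi : y i ≠ 0)
    (hij : i ≠ j) (hE : MeasurableSet E) (hEi : E ⊆ κ ⁻¹' {i})
    (htie : ∀ ω ∈ E, ‖f ω - y j‖ = ‖f ω - y i‖) :
    IsBestConst f p (μ.restrict E) (y i) := by
  classical
  have hfinite : IsFiniteMeasure (μ.restrict (κ ⁻¹' {i})) :=
    isFiniteMeasure_restrict.2 (measure_fiber_ne_top (one_pos.trans hp₁).ne' hp hκ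
      (memLp_comp_of_eLpNorm_sub_ne_top hf hκ (hopt.trans_ne (quantError_ne_top hf))) hi)
  have hκ' : Measurable (E.piecewise (fun _ => j) κ) := measurable_const.piecewise hE hκ
  have hopt' := (eLpNorm_sub_comp_piecewise (p := p) (μ := μ) fun ω hω =>
    (htie ω hω).trans (by rw [show κ ω = i from hEi hω])).trans hopt
  have hfiber : E.piecewise (fun _ => j) κ ⁻¹' {i} = Eᶜ ∩ κ ⁻¹' {i} := by
    ext ω
    by_cases hω : ω ∈ E <;> simp [hω, hij.symm]
  have hcompl : IsBestConst f p ((μ.restrict (κ ⁻¹' {i})).restrict Eᶜ) (y i) := by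
    rw [Measure.restrict_restrict hE.compl, ← hfiber]
    exact isBestConst_restrict_fiber hp₁.le hp hf hκ' hopt' i
  have h := hX.isBestConst_restrict_of_compl hp₁ hp (hf.restrict _) hE
    (isBestConst_restrict_fiber hp₁.le hp hf hκ hopt i) hcompl
  rwa [Measure.restrict_restrict hE, Set.inter_eq_self_of_subset_left hEi] at h

theorem GateauxDifferentiableNorm.ae_norm_sub_ne_of_ne_zero (hX : GateauxDifferentiableNorm X)
    (hp₁ : 1 < p) (hp : p ≠ ∞) (hfm : StronglyMeasurable f) (hf : MemLp f p μ) (hκ : Measurable κ)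
    (hopt : eLpNorm (fun ω => f ω - y (κ ω)) p μ = quantError ι f p μ) (hi : y i ≠ 0)
    (hij : y i ≠ y j) :
    ∀ᵐ ω ∂μ, κ ω = i → ‖f ω - y j‖ ≠ ‖f ω - y i‖ := by
  let B : Set Ω := κ ⁻¹' {i} ∩ {ω | ‖f ω - y j‖ = ‖f ω - y i‖}
  have hB : MeasurableSet B :=
    (hκ (measurableSet_singleton i)).inter (measurableSet_norm_sub_eq hfm (y j) (y i))
  have hfinite : IsFiniteMeasure (μ.restrict B) :=
    isFiniteMeasure_restrict.2 (measure_ne_top_of_subset Set.inter_subset_left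
      (measure_fiber_ne_top (one_pos.trans hp₁).ne' hp hκ
        (memLp_comp_of_eLpNorm_sub_ne_top hf hκ (hopt.trans_ne (quantError_ne_top hf))) hi))
  have heq : ∀ᵐ ω ∂μ.restrict B, f ω = y i :=
    ae_eq_of_forall_isBestConst (one_pos.trans hp₁).ne' hp hfm (hf.restrict B) fun E hE => by
      rw [Measure.restrict_restrict hE]
      exact hX.isBestConst_restrict_of_tie hp₁ hp hf hκ hopt hi (fun h => hij (congrArg y h))
        (hE.inter hB) (fun ω hω => hω.2.1) (fun ω hω => hω.2.2)
  filter_upwards [(ae_restrict_iff' hB).1 heq] with ω hω hκω htie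
  have hfi : f ω = y i := hω ⟨hκω, htie⟩
  rw [hfi, sub_self, norm_zero, norm_eq_zero, sub_eq_zero] at htie
  exact hij htie

theorem GateauxDifferentiableNorm.ae_norm_sub_ne (hX : GateauxDifferentiableNorm X)
    (hp₁ : 1 < p) (hp : p ≠ ∞) (hfm : StronglyMeasurable f) (hf : MemLp f p μ) (hκ : Measurable κ)
    (hopt : eLpNorm (fun ω => f ω - y (κ ω)) p μ = quantError ι f p μ) (hij : y i ≠ y j) :
    ∀ᵐ ω ∂μ, κ ω = i → ‖f ω - y j‖ ≠ ‖f ω - y i‖ := by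
  classical
  by_cases hi : y i = 0
  swap
  · exact hX.ae_norm_sub_ne_of_ne_zero hp₁ hp hfm hf hκ hopt hi hij
  let B : Set Ω := κ ⁻¹' {i} ∩ {ω | ‖f ω - y j‖ = ‖f ω - y i‖}
  have hB : MeasurableSet B :=
    (hκ (measurableSet_singleton i)).inter (measurableSet_norm_sub_eq hfm (y j) (y i))
  have hκ' : Measurable (B.piecewise (fun _ => j) κ) := measurable_const.piecewise hB hκ
  have hopt' : eLpNorm (fun ω => f ω - y (B.piecewise (fun _ => j) κ ω)) p μ =
      quantError ι f p μ :=
    (eLpNorm_sub_comp_piecewise fun ω hω =>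
      hω.2.trans (by rw [show κ ω = i from hω.1])).trans hopt
  have hj : y j ≠ 0 := fun hj => hij (hi.trans hj.symm)
  filter_upwards [hX.ae_norm_sub_ne_of_ne_zero hp₁ hp hfm hf hκ' hopt' hj hij.symm]
    with ω hω hκω htie
  exact hω (B.piecewise_eq_of_mem _ _ ⟨hκω, htie⟩) htie.symm

theorem GateauxDifferentiableNorm.ae_eq_of_norm_sub_eq (hX : GateauxDifferentiableNorm X)
    (hp₁ : 1 < p) (hp : p ≠ ∞) (hfm : StronglyMeasurable f) (hf : MemLp f p μ) (hκ : Measurable κ)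
    (hopt : eLpNorm (fun ω => f ω - y (κ ω)) p μ = quantError ι f p μ) :
    ∀ᵐ ω ∂μ, ∀ j, ‖f ω - y j‖ = ‖f ω - y (κ ω)‖ → y j = y (κ ω) := by
  have hne : ∀ i j, ∀ᵐ ω ∂μ, y i ≠ y j → κ ω = i → ‖f ω - y j‖ ≠ ‖f ω - y i‖ := fun i j => by
    by_cases hij : y i = y j
    · exact .of_forall fun ω h => absurd hij h
    · exact (hX.ae_norm_sub_ne hp₁ hp hfm hf hκ hopt hij).mono fun ω h _ => h
  filter_upwards [eventually_countable_forall.2 fun i => eventually_countable_forall.2 (hne i)]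
    with ω hω j htie
  by_contra hj
  exact hω (κ ω) j (Ne.symm hj) rfl htie

end Ties

theorem exists_measurable_argmin {Ω ι : Type*} [MeasurableSpace Ω] [MeasurableSpace ι] [Finite ι]
    [Nonempty ι] {u : ι → Ω → ℝ≥0∞} (hu : ∀ i, Measurable (u i)) :
    ∃ κ : Ω → ι, Measurable κ ∧ ∀ ω i, u (κ ω) ω ≤ u i ω := by
  classical
  obtain ⟨e, he⟩ := exists_surjective_nat ι
  have hex : ∀ ω, ∃ n, ∀ i, u (e n) ω ≤ u i ω := fun ω => by
    obtain ⟨i, hi⟩ := Finite.exists_min fun i => u i ω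
    obtain ⟨n, rfl⟩ := he i
    exact ⟨n, hi⟩
  refine ⟨fun ω => e (Nat.find (hex ω)), measurable_from_nat.comp (measurable_find hex fun n => ?_),
    fun ω => Nat.find_spec (hex ω)⟩
  simp only [Set.ofPred_forall]
  exact .iInter fun i => measurableSet_le (hu _) (hu i)

section Subsequences

variable {Ω : Type*} [MeasurableSpace Ω] {μ : Measure Ω}

theorem exists_subseq_tendsto_zero_ae {v : ℕ → Ω → ℝ≥0∞} (hv : ∀ n, AEMeasurable (v n) μ)
    (h : Tendsto (fun n => ∫⁻ ω, v n ω ∂μ) atTop (𝓝 0)) :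
    ∃ φ : ℕ → ℕ, StrictMono φ ∧ ∀ᵐ ω ∂μ, Tendsto (fun n => v (φ n) ω) atTop (𝓝 0) := by
  obtain ⟨ε, hε, hsum⟩ := ENNReal.exists_pos_sum_of_countable one_ne_zero ℕ
  obtain ⟨φ, hφ, hle⟩ := extraction_forall_of_eventually (P := fun n m => ∫⁻ ω, v m ω ∂μ < ε n)
    fun n => h.eventually_lt_const (by exact_mod_cast hε n)
  refine ⟨φ, hφ, ?_⟩
  have hfinite : ∫⁻ ω, ∑' n, v (φ n) ω ∂μ ≠ ∞ := by
    rw [lintegral_tsum fun n => hv (φ n)]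
    exact ((ENNReal.tsum_le_tsum fun n => (hle n).le).trans_lt (hsum.trans ENNReal.one_lt_top)).ne
  filter_upwards [ae_lt_top' (AEMeasurable.tsum fun n => hv (φ n)) hfinite] with ω hω
  exact ENNReal.tendsto_atTop_zero_of_tsum_ne_top hω.ne

theorem exists_subseq_ae_eventually_notMem {A : ℕ → Set Ω} (hA : ∀ n, MeasurableSet (A n))
    (h : Tendsto (fun n => μ (A n)) atTop (𝓝 0)) :
    ∃ φ : ℕ → ℕ, StrictMono φ ∧ ∀ᵐ ω ∂μ, ∀ᶠ n in atTop, ω ∉ A (φ n) := by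
  obtain ⟨φ, hφ, hae⟩ := exists_subseq_tendsto_zero_ae (μ := μ)
    (v := fun n => (A n).indicator 1) (fun n => (measurable_one.indicator (hA n)).aemeasurable)
    (by simpa only [lintegral_indicator_one (hA _)] using h)
  refine ⟨φ, hφ, hae.mono fun ω hω => (hω.eventually_lt_const one_pos).mono fun n hn hmem => ?_⟩
  simp [hmem] at hn

end Subsequences

section Scheffe

theorem tendsto_sub_zero_of_le_liminf {a : ℕ → ℝ≥0∞} {b : ℝ≥0∞} (hb : b ≠ ∞)
    (h : b ≤ liminf a atTop) : Tendsto (fun n => b - a n) atTop (𝓝 0) := by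
  refine tendsto_of_le_liminf_of_limsup_le bot_le ?_
  rw [ENNReal.limsup_const_sub _ _ hb, tsub_eq_zero_of_le h]

variable {Ω : Type*} [MeasurableSpace Ω] {μ : Measure Ω} {φ : ℕ → Ω → ℝ≥0∞} {ψ : Ω → ℝ≥0∞}

theorem tendsto_lintegral_sub_zero_of_le_liminf (hφ : ∀ n, AEMeasurable (φ n) μ)
    (hψ : AEMeasurable ψ μ) (hψ_fin : ∫⁻ ω, ψ ω ∂μ ≠ ∞)
    (hle : ∀ᵐ ω ∂μ, ψ ω ≤ liminf (fun n => φ n ω) atTop) :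
    Tendsto (fun n => ∫⁻ ω, (ψ ω - φ n ω) ∂μ) atTop (𝓝 0) := by
  have hzero : ∀ᵐ ω ∂μ, Tendsto (fun n => ψ ω - φ n ω) atTop (𝓝 0) := by
    filter_upwards [hle, ae_lt_top' hψ hψ_fin] with ω hω hfin
    exact tendsto_sub_zero_of_le_liminf hfin.ne hω
  simpa only [lintegral_zero, Pi.sub_apply] using tendsto_lintegral_of_dominated_convergence' ψ
    (fun n => hψ.sub (hφ n)) (fun n => .of_forall fun ω => tsub_le_self) hψ_fin hzero

theorem tendsto_lintegral_sub_zero_of_tendsto_lintegral (hφ : ∀ n, AEMeasurable (φ n) μ)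
    (hψ : AEMeasurable ψ μ) (hψ_fin : ∫⁻ ω, ψ ω ∂μ ≠ ∞)
    (hle : ∀ᵐ ω ∂μ, ψ ω ≤ liminf (fun n => φ n ω) atTop)
    (hlim : Tendsto (fun n => ∫⁻ ω, φ n ω ∂μ) atTop (𝓝 (∫⁻ ω, ψ ω ∂μ))) :
    Tendsto (fun n => ∫⁻ ω, (φ n ω - ψ ω) ∂μ) atTop (𝓝 0) := by
  have hbalance : ∀ n, ∫⁻ ω, (φ n ω - ψ ω) ∂μ =
      (∫⁻ ω, φ n ω ∂μ + ∫⁻ ω, (ψ ω - φ n ω) ∂μ) - ∫⁻ ω, ψ ω ∂μ := fun n => by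
    refine ENNReal.eq_sub_of_add_eq hψ_fin ?_
    rw [← lintegral_add_right' _ hψ, ← lintegral_add_left' (hφ n)]
    simp only [tsub_add_eq_max, add_tsub_eq_max]
  have hsum := hlim.add (tendsto_lintegral_sub_zero_of_le_liminf hφ hψ hψ_fin hle)
  rw [add_zero] at hsum
  simpa only [hbalance, tsub_self] using
    ENNReal.Tendsto.sub hsum tendsto_const_nhds (.inr hψ_fin)

theorem exists_subseq_tendsto_ae_of_le_liminf (hφ : ∀ n, AEMeasurable (φ n) μ)
    (hψ : AEMeasurable ψ μ) (hψ_fin : ∫⁻ ω, ψ ω ∂μ ≠ ∞)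
    (hle : ∀ᵐ ω ∂μ, ψ ω ≤ liminf (fun n => φ n ω) atTop)
    (hlim : Tendsto (fun n => ∫⁻ ω, φ n ω ∂μ) atTop (𝓝 (∫⁻ ω, ψ ω ∂μ))) :
    ∃ σ : ℕ → ℕ, StrictMono σ ∧ ∀ᵐ ω ∂μ, Tendsto (fun n => φ (σ n) ω) atTop (𝓝 (ψ ω)) := by
  obtain ⟨σ, hσ, hae⟩ := exists_subseq_tendsto_zero_ae (fun n => (hφ n).sub hψ)
    (tendsto_lintegral_sub_zero_of_tendsto_lintegral hφ hψ hψ_fin hle hlim)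
  refine ⟨σ, hσ, ?_⟩
  filter_upwards [hae, hle, ae_lt_top' hψ hψ_fin] with ω hupper hω hfin
  have hlower := (tendsto_sub_zero_of_le_liminf hfin.ne hω).comp hσ.tendsto_atTop
  refine tendsto_of_tendsto_of_tendsto_of_le_of_le
    (g := fun n => ψ ω - (ψ ω - φ (σ n) ω)) (h := fun n => ψ ω + (φ (σ n) ω - ψ ω)) ?_ ?_
    (fun n => tsub_tsub_le) (fun n => le_add_tsub)
  · simpa only [tsub_zero, Function.comp_apply] using
      ENNReal.Tendsto.sub tendsto_const_nhds hlower (.inl hfin.ne)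
  · simpa only [add_zero, Pi.sub_apply] using tendsto_const_nhds.add hupper

end Scheffe

section NearestValue

variable {ι : Type*} [Finite ι] {V : Set ι} {j : ℕ → ι}

theorem le_liminf_apply_of_eventually_notMem {u : ℕ → ι → ℝ≥0∞} {L : ι → ℝ≥0∞} {r : ℝ≥0∞}
    (hu : ∀ i ∉ V, Tendsto (fun n => u n i) atTop (𝓝 (L i))) (hr : ∀ i, r ≤ L i)
    (hj : ∀ᶠ n in atTop, j n ∉ V) : r ≤ liminf (fun n => u n (j n)) atTop := by
  refine le_of_forall_lt_imp_le_of_dense fun c hc => le_liminf_of_le (by isBoundedDefault) ?_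
  have hlow : ∀ᶠ n in atTop, ∀ i : ι, i ∉ V → c ≤ u n i :=
    eventually_all.2 fun i => eventually_imp_distrib_left.2 fun hi =>
      (hu i hi).eventually_const_le (hc.trans_le (hr i))
  filter_upwards [hlow, hj] with n hn hjn using hn _ hjn

theorem tendsto_apply_of_tendsto_norm_sub {X : Type*} [NormedAddCommGroup X] {y : X}
    {x : ℕ → ι → X} {b : ι → X} (hx : ∀ i ∉ V, Tendsto (fun n => x n i) atTop (𝓝 (b i)))
    (hj : ∀ᶠ n in atTop, j n ∉ V) {i₀ : ι}
    (hlim : Tendsto (fun n => ‖y - x n (j n)‖) atTop (𝓝 ‖y - b i₀‖))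
    (hties : ∀ i, ‖y - b i‖ = ‖y - b i₀‖ → b i = b i₀) :
    Tendsto (fun n => x n (j n)) atTop (𝓝 (b i₀)) := by
  refine tendsto_def.2 fun S hS => ?_
  have hmem : ∀ᶠ n in atTop, ∀ i, i ∉ V → j n = i → x n i ∈ S := by
    refine eventually_all.2 fun i => eventually_imp_distrib_left.2 fun hi => ?_
    by_cases htie : ‖y - b i‖ = ‖y - b i₀‖
    · exact ((hx i hi).eventually_mem (hties i htie ▸ hS)).mono fun n hn _ => hn
    · have hgap := ((hx i hi).const_sub y).norm.sub hlim
      filter_upwards [hgap.eventually_ne (sub_ne_zero.2 htie)] with n hn hij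
      exact absurd (by rw [hij, sub_self]) hn
  filter_upwards [hmem, hj] with n hn hjn using hn _ hjn rfl

end NearestValue

section MinimizingSequences

variable {Ω : Type*} [MeasurableSpace Ω] {μ : Measure Ω} {X : Type*} [NormedAddCommGroup X]
  {ι : Type*} [Finite ι] {p : ℝ≥0∞} {f : Ω → X} {κ : ℕ → Ω → ι} {x : ℕ → ι → X} {V : Set ι}
  {b : ι → X} {κ' : Ω → ι}

theorem ae_enorm_rpow_le_liminf (hV : ∀ᵐ ω ∂μ, ∀ᶠ n in atTop, κ n ω ∉ V)
    (hx : ∀ i ∉ V, Tendsto (fun n => x n i) atTop (𝓝 (b i)))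
    (hle : ∀ ω i, ‖f ω - b (κ' ω)‖ₑ ≤ ‖f ω - b i‖ₑ) {q : ℝ} (hq : 0 ≤ q) :
    ∀ᵐ ω ∂μ, ‖f ω - b (κ' ω)‖ₑ ^ q ≤ liminf (fun n => ‖f ω - x n (κ n ω)‖ₑ ^ q) atTop :=
  hV.mono fun ω hω => le_liminf_apply_of_eventually_notMem
    (u := fun n i => ‖f ω - x n i‖ₑ ^ q)
    (fun i hi => ((hx i hi).const_sub (f ω)).enorm.ennrpow_const q)
    (fun i => ENNReal.rpow_le_rpow (hle ω i) hq) hω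

variable [MeasurableSpace ι] [MeasurableSingletonClass ι]

theorem exists_subseq_eventually_notMem_and_tendsto [Nonempty ι] [NormedSpace ℝ X]
    [UniformConvexSpace X] [CompleteSpace X] (hp₁ : 1 < p) (hp : p ≠ ∞) (hf : MemLp f p μ)
    (hκ : ∀ n, Measurable (κ n)) (hcost : ∀ n, eLpNorm (fun ω => f ω - x n (κ n ω)) p μ ≠ ∞)
    (hmin : Tendsto (fun n => eLpNorm (fun ω => f ω - x n (κ n ω)) p μ) atTop
      (𝓝 (quantError ι f p μ))) :
    ∃ φ : ℕ → ℕ, StrictMono φ ∧ ∃ (V : Set ι) (b : ι → X),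
      (∀ᵐ ω ∂μ, ∀ᶠ n in atTop, κ (φ n) ω ∉ V) ∧
      ∀ i ∉ V, Tendsto (fun n => x (φ n) i) atTop (𝓝 (b i)) := by
  obtain ⟨φ, hφ, hlabels⟩ :=
    exists_subseq_measure_fiber_tendsto_zero_or_tendsto hp₁ hp hf hκ hcost hmin
  let V : Set ι := {i | Tendsto (fun n => μ (κ (φ n) ⁻¹' {i})) atTop (𝓝 0)}
  have hV : Tendsto (fun n => μ (κ (φ n) ⁻¹' V)) atTop (𝓝 0) := by
    have hsum := tendsto_finsetSum V.toFinite.toFinset fun i hi => V.toFinite.mem_toFinset.1 hi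
    rw [Finset.sum_const_zero] at hsum
    refine tendsto_of_tendsto_of_tendsto_of_le_of_le tendsto_const_nhds hsum (fun _ => bot_le)
      fun n => ?_
    refine (measure_mono fun ω hω => ?_).trans (measure_biUnion_finset_le _ _)
    exact Set.mem_biUnion (V.toFinite.mem_toFinset.2 hω) rfl
  obtain ⟨ψ, hψ, hae⟩ := exists_subseq_ae_eventually_notMem
    (fun n => hκ (φ n) V.toFinite.measurableSet) hV
  have hb : ∀ i, ∃ b, i ∉ V → Tendsto (fun n => x (φ n) i) atTop (𝓝 b) := fun i =>
    (hlabels i).elim (fun hi => ⟨0, fun h => (h hi).elim⟩) fun ⟨b, hb⟩ => ⟨b, fun _ => hb⟩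
  choose b hb using hb
  exact ⟨φ ∘ ψ, hφ.comp hψ, V, b, hae, fun i hi => (hb i hi).comp hψ.tendsto_atTop⟩

theorem aemeasurable_enorm_sub_comp_rpow (hf : AEStronglyMeasurable f μ) (hκ' : Measurable κ')
    (y : ι → X) (q : ℝ) : AEMeasurable (fun ω => ‖f ω - y (κ' ω)‖ₑ ^ q) μ :=
  (hf.sub (StronglyMeasurable.of_discrete.comp_measurable hκ').aestronglyMeasurable).enorm.pow_const
    q

theorem eLpNorm_eq_quantError_of_tendsto (hp₀ : p ≠ 0) (hp : p ≠ ∞)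
    (hf : AEStronglyMeasurable f μ) (hκ : ∀ n, Measurable (κ n))
    (hmin : Tendsto (fun n => eLpNorm (fun ω => f ω - x n (κ n ω)) p μ) atTop
      (𝓝 (quantError ι f p μ)))
    (hV : ∀ᵐ ω ∂μ, ∀ᶠ n in atTop, κ n ω ∉ V)
    (hx : ∀ i ∉ V, Tendsto (fun n => x n i) atTop (𝓝 (b i))) (hκ' : Measurable κ')
    (hle : ∀ ω i, ‖f ω - b (κ' ω)‖ₑ ≤ ‖f ω - b i‖ₑ) :
    eLpNorm (fun ω => f ω - b (κ' ω)) p μ = quantError ι f p μ := by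
  have hq : 0 < p.toReal := ENNReal.toReal_pos hp₀ hp
  refine le_antisymm ((ENNReal.rpow_le_rpow_iff hq).1 ?_) (quantError_le hκ' b)
  calc eLpNorm (fun ω => f ω - b (κ' ω)) p μ ^ p.toReal
      = ∫⁻ ω, ‖f ω - b (κ' ω)‖ₑ ^ p.toReal ∂μ := eLpNorm_rpow_toReal hp₀ hp _ _
    _ ≤ ∫⁻ ω, liminf (fun n => ‖f ω - x n (κ n ω)‖ₑ ^ p.toReal) atTop ∂μ :=
        lintegral_mono_ae (ae_enorm_rpow_le_liminf hV hx hle hq.le)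
    _ ≤ liminf (fun n => ∫⁻ ω, ‖f ω - x n (κ n ω)‖ₑ ^ p.toReal ∂μ) atTop :=
        lintegral_liminf_le' fun n => aemeasurable_enorm_sub_comp_rpow hf (hκ n) (x n) _
    _ = quantError ι f p μ ^ p.toReal := by
        simp only [← eLpNorm_rpow_toReal hp₀ hp]
        exact (hmin.ennrpow_const _).liminf_eq

theorem exists_subseq_tendsto_norm_sub_ae [Nonempty ι] (hp₀ : p ≠ 0) (hp : p ≠ ∞)
    (hf : MemLp f p μ) (hκ : ∀ n, Measurable (κ n))
    (hmin : Tendsto (fun n => eLpNorm (fun ω => f ω - x n (κ n ω)) p μ) atTop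
      (𝓝 (quantError ι f p μ)))
    (hV : ∀ᵐ ω ∂μ, ∀ᶠ n in atTop, κ n ω ∉ V)
    (hx : ∀ i ∉ V, Tendsto (fun n => x n i) atTop (𝓝 (b i))) (hκ' : Measurable κ')
    (hle : ∀ ω i, ‖f ω - b (κ' ω)‖ₑ ≤ ‖f ω - b i‖ₑ) :
    ∃ φ : ℕ → ℕ, StrictMono φ ∧ ∀ᵐ ω ∂μ,
      Tendsto (fun n => ‖f ω - x (φ n) (κ (φ n) ω)‖) atTop (𝓝 ‖f ω - b (κ' ω)‖) := by
  have hq : 0 < p.toReal := ENNReal.toReal_pos hp₀ hp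
  have hopt := eLpNorm_eq_quantError_of_tendsto hp₀ hp hf.1 hκ hmin hV hx hκ' hle
  have hfin : ∫⁻ ω, ‖f ω - b (κ' ω)‖ₑ ^ p.toReal ∂μ ≠ ∞ := by
    rw [← eLpNorm_rpow_toReal hp₀ hp, hopt]
    exact ENNReal.rpow_ne_top_of_nonneg hq.le (quantError_ne_top hf)
  have hpow := hmin.ennrpow_const p.toReal
  simp only [← hopt, eLpNorm_rpow_toReal hp₀ hp] at hpow
  obtain ⟨φ, hφ, hae⟩ := exists_subseq_tendsto_ae_of_le_liminf
    (fun n => aemeasurable_enorm_sub_comp_rpow hf.1 (hκ n) (x n) _)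
    (aemeasurable_enorm_sub_comp_rpow hf.1 hκ' b _) hfin
    (ae_enorm_rpow_le_liminf hV hx hle hq.le) hpow
  refine ⟨φ, hφ, hae.mono fun ω hω => ?_⟩
  have hroot := hω.ennrpow_const p.toReal⁻¹
  simp only [ENNReal.rpow_rpow_inv hq.ne'] at hroot
  simpa only [Function.comp_def, toReal_enorm] using
    (ENNReal.tendsto_toReal enorm_ne_top).comp hroot

theorem GateauxDifferentiableNorm.exists_subseq_tendsto_eLpNorm [Nonempty ι] [NormedSpace ℝ X]
    [UniformConvexSpace X] [CompleteSpace X] (hX : GateauxDifferentiableNorm X) (hp₁ : 1 < p)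
    (hp : p ≠ ∞) (hfm : StronglyMeasurable f) (hf : MemLp f p μ) (hκ : ∀ n, Measurable (κ n))
    (hcost : ∀ n, eLpNorm (fun ω => f ω - x n (κ n ω)) p μ ≠ ∞)
    (hmin : Tendsto (fun n => eLpNorm (fun ω => f ω - x n (κ n ω)) p μ) atTop
      (𝓝 (quantError ι f p μ))) :
    ∃ φ : ℕ → ℕ, StrictMono φ ∧ ∃ (κ' : Ω → ι) (b : ι → X), Measurable κ' ∧
      eLpNorm (fun ω => f ω - b (κ' ω)) p μ = quantError ι f p μ ∧
      Tendsto (fun n => eLpNorm (fun ω => x (φ n) (κ (φ n) ω) - b (κ' ω)) p μ) atTop (𝓝 0) := by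
  have hp₀ : p ≠ 0 := (one_pos.trans hp₁).ne'
  obtain ⟨φ, hφ, V, b, hV, hx⟩ :=
    exists_subseq_eventually_notMem_and_tendsto hp₁ hp hf hκ hcost hmin
  have hminφ := hmin.comp hφ.tendsto_atTop
  obtain ⟨κ', hκ', hle⟩ := exists_measurable_argmin fun i =>
    (hfm.sub (stronglyMeasurable_const (b := b i))).enorm
  have hopt := eLpNorm_eq_quantError_of_tendsto hp₀ hp hf.1 (fun n => hκ (φ n)) hminφ hV hx hκ' hle
  obtain ⟨ψ, hψ, hnorm⟩ := exists_subseq_tendsto_norm_sub_ae hp₀ hp hf (fun n => hκ (φ n))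
    hminφ hV hx hκ' hle
  have hvalues : ∀ᵐ ω ∂μ,
      Tendsto (fun n => x (φ (ψ n)) (κ (φ (ψ n)) ω)) atTop (𝓝 (b (κ' ω))) := by
    filter_upwards [hV, hnorm, hX.ae_eq_of_norm_sub_eq hp₁ hp hfm hf hκ' hopt]
      with ω hω hnormω hties
    exact tendsto_apply_of_tendsto_norm_sub
      (fun i hi => (hx i hi).comp hψ.tendsto_atTop) (hψ.tendsto_atTop.eventually hω) hnormω hties
  have hmeas : ∀ {κ₀ : Ω → ι} (y : ι → X), Measurable κ₀ →
      AEStronglyMeasurable (fun ω => f ω - y (κ₀ ω)) μ := fun y h₀ =>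
    hf.1.sub (StronglyMeasurable.of_discrete.comp_measurable h₀).aestronglyMeasurable
  have hstrong := tendsto_eLpNorm_sub_zero_of_tendsto_ae hp₁ hp
    (F := fun n ω => f ω - x (φ (ψ n)) (κ (φ (ψ n)) ω)) (fun n => hmeas _ (hκ _))
    ⟨hmeas b hκ', hopt.trans_lt (quantError_ne_top hf).lt_top⟩
    (hvalues.mono fun ω hω => hω.const_sub (f ω))
    (hopt ▸ hminφ.comp hψ.tendsto_atTop)
  refine ⟨φ ∘ ψ, hφ.comp hψ, κ', b, hκ', hopt, hstrong.congr fun n => ?_⟩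
  refine eLpNorm_congr_norm_ae (.of_forall fun ω => ?_)
  simp only [Pi.sub_apply, Function.comp_apply, sub_sub_sub_cancel_left, norm_sub_rev]

end MinimizingSequences

section KValuedSimple

variable {Ω : Type*} [MeasurableSpace Ω] {μ : Measure Ω} {X : Type*} [NormedAddCommGroup X]
  {p : ℝ≥0∞} {k : ℕ}

theorem exists_measurable_label_of_partition {l : ℕ} {A : Fin l → Set Ω}
    (hA : ∀ i, MeasurableSet (A i)) (hdisj : Pairwise fun i j => Disjoint (A i) (A j))
    (hcover : ⋃ i, A i = Set.univ) : ∃ j : Ω → Fin l, Measurable j ∧ ∀ ω i, ω ∈ A i ↔ j ω = i := by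
  choose j hj using fun ω => Set.mem_iUnion.1 (hcover ▸ Set.mem_univ ω)
  have hlabel : ∀ ω i, ω ∈ A i ↔ j ω = i := fun ω i =>
    ⟨fun hi => by_contra fun hne => Set.disjoint_left.1 (hdisj hne) (hj ω) hi, fun hi => hi ▸ hj ω⟩
  refine ⟨j, measurable_to_countable' fun i => ?_, hlabel⟩
  rw [show j ⁻¹' {i} = A i from Set.ext fun ω => (hlabel ω i).symm]
  exact hA i

theorem mem_kValuedSimple_iff {g : Lp X p μ} :
    g ∈ kValuedSimple X p μ k ↔ ∃ (κ : Ω → Fin k) (x : Fin k → X), Measurable κ ∧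
      g =ᵐ[μ] fun ω => x (κ ω) := by
  classical
  constructor
  · rintro ⟨l, hl, A, x, hA, hdisj, hcover, hg⟩
    obtain ⟨j, hj, hlabel⟩ := exists_measurable_label_of_partition hA hdisj hcover
    refine ⟨Fin.castLE hl ∘ j, fun i => if h : (i : ℕ) < l then x ⟨i, h⟩ else 0,
      (measurable_from_top (f := Fin.castLE hl)).comp hj, hg.trans (.of_forall fun ω => ?_)⟩
    simp [Set.indicator_apply, hlabel]
  · rintro ⟨κ, x, hκ, hg⟩
    refine ⟨k, le_rfl, fun i => κ ⁻¹' {i}, x, fun i => hκ (measurableSet_singleton i),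
      fun i j hij => .preimage _ (Set.disjoint_singleton.2 hij),
      Set.iUnion_eq_univ_iff.2 fun ω => ⟨κ ω, rfl⟩, hg.trans (.of_forall fun ω => ?_)⟩
    simp [Set.indicator_apply]

theorem edist_eq_eLpNorm_sub_of_ae_eq {F G : Lp X p μ} {f g : Ω → X} (hf : F =ᵐ[μ] f)
    (hg : G =ᵐ[μ] g) : edist F G = eLpNorm (fun ω => f ω - g ω) p μ :=
  (Lp.edist_def F G).trans (eLpNorm_congr_ae (hf.sub hg))

theorem exists_mem_kValuedSimple_ae_eq {f : Lp X p μ} {κ : Ω → Fin k} (hκ : Measurable κ)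
    {y : Fin k → X} (hy : eLpNorm (fun ω => f ω - y (κ ω)) p μ ≠ ∞) :
    ∃ g ∈ kValuedSimple X p μ k, g =ᵐ[μ] fun ω => y (κ ω) := by
  have hmem : MemLp (fun ω => y (κ ω)) p μ :=
    memLp_comp_of_eLpNorm_sub_ne_top (Lp.memLp f) hκ hy
  exact ⟨hmem.toLp _, mem_kValuedSimple_iff.2 ⟨κ, y, hκ, hmem.coeFn_toLp⟩, hmem.coeFn_toLp⟩

variable [Fact (1 ≤ p)]

theorem infEDist_kValuedSimple (f : Lp X p μ) :
    Metric.infEDist f (kValuedSimple X p μ k) = quantError (Fin k) f p μ := by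
  refine le_antisymm (le_iInf₂ fun κ hκ => le_iInf fun y => ?_) (le_iInf₂ fun g hg => ?_)
  · rcases eq_or_ne (eLpNorm (fun ω => f ω - y (κ ω)) p μ) ∞ with hy | hy
    · exact hy ▸ le_top
    · obtain ⟨g, hg, hgy⟩ := exists_mem_kValuedSimple_ae_eq hκ hy
      rw [← edist_eq_eLpNorm_sub_of_ae_eq (ae_eq_refl f) hgy]
      exact Metric.infEDist_le_edist_of_mem hg
  · obtain ⟨κ, y, hκ, hgy⟩ := mem_kValuedSimple_iff.1 hg
    rw [edist_eq_eLpNorm_sub_of_ae_eq (ae_eq_refl f) hgy]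
    exact quantError_le hκ y

theorem IsMinimizingSeq.tendsto_edist {Z : Type*} [NormedAddCommGroup Z] {K : Set Z} {z : Z}
    {w : ℕ → Z} (hw : IsMinimizingSeq K z w) :
    Tendsto (fun n => edist z (w n)) atTop (𝓝 (Metric.infEDist z K)) := by
  have hlim := ENNReal.tendsto_ofReal hw.2
  rw [Metric.infDist, ENNReal.ofReal_toReal (Metric.infEDist_ne_top ⟨_, hw.1 0⟩)] at hlim
  simpa only [← dist_eq_norm, ← edist_dist] using hlim

theorem IsMinimizingSeq.exists_subseq_tendsto_minimizer [NormedSpace ℝ X] [CompleteSpace X]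
    [UniformConvexSpace X] (hX : GateauxDifferentiableNorm X) (hp₁ : 1 < p) (hp : p ≠ ∞)
    (hk : 1 ≤ k) {f : Lp X p μ} {h : ℕ → Lp X p μ}
    (hh : IsMinimizingSeq (kValuedSimple X p μ k) f h) :
    ∃ (φ : ℕ → ℕ) (g : Lp X p μ), StrictMono φ ∧
      IsMinimizer (kValuedSimple X p μ k) f g ∧ Tendsto (fun n => h (φ n)) atTop (𝓝 g) := by
  have : Nonempty (Fin k) := ⟨⟨0, hk⟩⟩
  choose κ x hκ hx using fun n => mem_kValuedSimple_iff.1 (hh.1 n)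
  have hcost : ∀ n, edist f (h n) = eLpNorm (fun ω => f ω - x n (κ n ω)) p μ := fun n =>
    edist_eq_eLpNorm_sub_of_ae_eq (ae_eq_refl f) (hx n)
  have hmin := hh.tendsto_edist
  simp only [hcost, infEDist_kValuedSimple] at hmin
  obtain ⟨φ, hφ, κ', b, hκ', hopt, hlim⟩ := hX.exists_subseq_tendsto_eLpNorm hp₁ hp
    (Lp.stronglyMeasurable f) (Lp.memLp f) hκ (fun n => hcost n ▸ edist_ne_top _ _) hmin
  obtain ⟨g, hg, hgb⟩ := exists_mem_kValuedSimple_ae_eq hκ'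
    (hopt.trans_ne (quantError_ne_top (Lp.memLp f)))
  refine ⟨φ, g, hφ, ⟨hg, ?_⟩, tendsto_iff_edist_tendsto_0.2 ?_⟩
  · rw [← dist_eq_norm, dist_edist, edist_eq_eLpNorm_sub_of_ae_eq (ae_eq_refl f) hgb, hopt,
      ← infEDist_kValuedSimple, Metric.infDist]
  · simpa only [edist_eq_eLpNorm_sub_of_ae_eq (hx _) hgb] using hlim

end KValuedSimple

theorem corollary3 {Ω : Type*} [MeasurableSpace Ω] (μ : Measure Ω)
    {X : Type*} [NormedAddCommGroup X] [NormedSpace ℝ X] [CompleteSpace X]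
    [UniformConvexSpace X] (hX : GateauxDifferentiableNorm X)
    (p : ℝ≥0∞) [Fact (1 ≤ p)] (hp_one : 1 < p) (hp_top : p < ∞) (k : ℕ) (hk : 1 ≤ k) :
    ApproximativelyNormCompact (kValuedSimple X p μ k) ∧
      ∀ (f : Lp X p μ) (h : ℕ → Lp X p μ), IsMinimizingSeq (kValuedSimple X p μ k) f h →
        ∃ (φ : ℕ → ℕ) (g : Lp X p μ), StrictMono φ ∧
          IsMinimizer (kValuedSimple X p μ k) f g ∧
          Tendsto (fun n => h (φ n)) atTop (𝓝 g) := by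
  have hsubseq : ∀ (f : Lp X p μ) (h : ℕ → Lp X p μ),
      IsMinimizingSeq (kValuedSimple X p μ k) f h → _ := fun f h hh =>
    hh.exists_subseq_tendsto_minimizer hX hp_one hp_top.ne hk
  refine ⟨fun f h hh => ?_, hsubseq⟩
  obtain ⟨φ, g, hφ, hg, hlim⟩ := hsubseq f h hh
  exact ⟨ℕ, inferInstance, inferInstance, inferInstance, φ, hφ.tendsto_atTop, g, hg.1, hlim⟩
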